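/- Let $X$ be a Fano manifold of complex dimension $n$ (compact and connected), let $T\simeq (S^1)^r$ be a maximal compact torus in $\mathrm{Aut}(X)$, and let $\xi_1,\dots,\xi_r$ be the holomorphic vector fields generating the factors of $T_{\mathbb C}\simeq(\mathbb C^*)^r$. Let $\omega_0\in 2\pi c_1(X)$ be a $T$-invariant Kähler form with Ricci potential $\rho_0$, i.e. $\mathrm{Ric}(\omega_0)-\omega_0=\sqrt{-1}\,\partial\bar\partial\rho_0$ and $\int_X(e^{\rho_0}-1)\,\omega_0^n=0$. Let $\varphi$ be a smooth real $T$-invariant function with $\omega_\varphi:=\omega_0+\sqrt{-1}\,\partial\bar\partial\varphi>0$, let $\mu_\varphi=(\theta_1,\dots,\theta_r):X\to\mathbb R^r$ be its moment map, i.e. $\iota_{\xi_\alpha}\omega_\varphi=\sqrt{-1}\,\bar\partial\theta_\alpha$ and $\int_X\theta_\alpha\,\omega_\varphi^n=0$ with $\theta_\alpha$ smooth and real, and let $P=\mu_\varphi(X)$ (a convex polytope independent of $\varphi$). Let $g:P\to\mathbb R$ be a smooth, positive, log-concave function and put $g_\varphi:=g\circ\mu_\varphi$, normalized by $\int_X(g_\varphi-1)\,\omega_\varphi^n=0$.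 Define the $g$-twisted Laplacian on smooth complex-valued functions by $$\Delta_{g,\varphi}u=-g_\varphi^{-1}\,\bar\partial^*\bigl(g_\varphi\,\bar\partial u\bigr),$$ where $\bar\partial^*$ is the formal adjoint of $\bar\partial$ with respect to $\omega_\varphi$. Suppose that, for some $t\in(0,1)$, $\varphi$ solves $$g_\varphi\,\omega_\varphi^n=e^{-t\varphi+\rho_0}\,\omega_0^n .$$ Then every non-zero eigenvalue $\lambda$ of $\Delta_{g,\varphi}$ is real and satisfies $\lambda+t<0$. In particular, if $\lambda_1$ denotes the first (largest) non-zero eigenvalue of $\Delta_{g,\varphi}$, then $\lambda_1+t<0$; that is, apart from the eigenvalue $t$ on the constant functions, the first eigenvalue of $\Delta_{g,\varphi}+t$ is negative. -/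

import Mathlib

open scoped Manifold ContDiff ComplexOrder

noncomputable section

namespace GSoliton

/-! ### Local calculus on `ℂⁿ` -/

/-- The Wirtinger derivative `∂F/∂zⁱ` at `y`. -/
def dz {n : ℕ} (F : (Fin n → ℂ) → ℂ) (i : Fin n) (y : Fin n → ℂ) : ℂ :=
  (1 / 2) * (fderiv ℝ F y (Pi.single i 1) - Complex.I * fderiv ℝ F y (Pi.single i Complex.I))

/-- The Wirtinger derivative `∂F/∂z̄ⁱ` at `y`. -/
def dzbar {n : ℕ} (F : (Fin n → ℂ) → ℂ) (i : Fin n) (y : Fin n → ℂ) : ℂ :=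
  (1 / 2) * (fderiv ℝ F y (Pi.single i 1) + Complex.I * fderiv ℝ F y (Pi.single i Complex.I))

/-! ### Functions and forms on a complex manifold -/

/-- Smooth (`C^∞` in the real sense) real valued functions on `X`. -/
def SmoothReal (n : ℕ) {X : Type*} [TopologicalSpace X] [ChartedSpace (Fin n → ℂ) X]
    (f : X → ℝ) : Prop :=
  ContMDiff 𝓘(ℝ, Fin n → ℂ) 𝓘(ℝ, ℝ) ∞ f

/-- Smooth (`C^∞` in the real sense) complex valued functions on `X`. -/
def SmoothComplex (n : ℕ) {X : Type*} [TopologicalSpace X] [ChartedSpace (Fin n → ℂ) X]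
    (f : X → ℂ) : Prop :=
  ContMDiff 𝓘(ℝ, Fin n → ℂ) 𝓘(ℝ, ℂ) ∞ f

/-- The components of a `(1,1)`-form in the holomorphic charts: `h e y i j` is the coefficient
`h_{i j̄}` at the point with coordinates `y` of the form `√-1 ∑ h_{i j̄} dzⁱ ∧ dz̄ʲ` in the
chart `e`. Only the values for `e` in the atlas and `y` in the target of `e` are meaningful. -/
abbrev Form11 (n : ℕ) (X : Type*) [TopologicalSpace X] : Type _ :=
  OpenPartialHomeomorph X (Fin n → ℂ) → (Fin n → ℂ) → Matrix (Fin n) (Fin n) ℂ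

/-- The components `α_{j̄}` of a `(0,1)`-form `∑ α_{j̄} dz̄ʲ` in the holomorphic charts. -/
abbrev Form01 (n : ℕ) (X : Type*) [TopologicalSpace X] : Type _ :=
  OpenPartialHomeomorph X (Fin n → ℂ) → (Fin n → ℂ) → Fin n → ℂ

section Manifold

variable {n : ℕ} {X : Type*} [TopologicalSpace X] [ChartedSpace (Fin n → ℂ) X]

/-- `F^* h = h` for a holomorphic map `F : X → X`, expressed in pairs of charts. For `F = id` it is
the transformation law of the components of a `(1,1)`-form under a change of coordinates. -/
def PreservedBy (F : X → X) (h : Form11 n X) : Prop :=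
  ∀ e ∈ atlas (Fin n → ℂ) X, ∀ e' ∈ atlas (Fin n → ℂ) X, ∀ x ∈ e.source, F x ∈ e'.source →
    ∀ i j : Fin n,
      h e (e x) i j = ∑ k, ∑ l, h e' (e' (F x)) k l
        * fderiv ℂ (fun y => e' (F (e.symm y))) (e x) (Pi.single i 1) k
        * starRingEnd ℂ (fderiv ℂ (fun y => e' (F (e.symm y))) (e x) (Pi.single j 1) l)

/-- Positivity of a real `(1,1)`-form. -/
def IsPositive (h : Form11 n X) : Prop :=
  ∀ e ∈ atlas (Fin n → ℂ) X, ∀ y ∈ e.target, (h e y).PosDef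

/-- `√-1 ∑ h_{i j̄} dzⁱ ∧ dz̄ʲ` is a Kähler form on `X`: a smooth, positive and
closed real `(1,1)`-form. -/
structure IsKahler (h : Form11 n X) : Prop where
  transform : PreservedBy id h
  smooth : ∀ e ∈ atlas (Fin n → ℂ) X, ∀ i j : Fin n, ContDiffOn ℝ ∞ (fun y => h e y i j) e.target
  positive : IsPositive h
  closed : ∀ e ∈ atlas (Fin n → ℂ) X, ∀ y ∈ e.target, ∀ i j k : Fin n,
    dz (fun y' => h e y' i j) k y = dz (fun y' => h e y' k j) i y

/-- The form `√-1 ∂∂̄ f`. -/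
def ddbar (f : X → ℝ) : Form11 n X :=
  fun e y => Matrix.of fun i j => dz (fun y' => dzbar (fun y'' => (f (e.symm y'') : ℂ)) j y') i y

/-- The density of `ωⁿ` with respect to the Lebesgue measure of the chart `e`, for
`ω = √-1 ∑ h_{i j̄} dzⁱ ∧ dz̄ʲ`; recall that `√-1 dz ∧ dz̄ = 2 dx ∧ dy`. -/
def volDensity (h : Form11 n X) (e : OpenPartialHomeomorph X (Fin n → ℂ)) (y : Fin n → ℂ) : ℝ :=
  (n.factorial : ℝ) * 2 ^ n * (h e y).det.re

/-- The measure `ωⁿ` on `X`. For a Kähler form the measures obtained from the charts are the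
restrictions of one measure to the domains of the charts, and that measure is their supremum. -/
def volMeasure [MeasurableSpace X] (h : Form11 n X) : MeasureTheory.Measure X :=
  ⨆ e ∈ atlas (Fin n → ℂ) X, MeasureTheory.Measure.map e.symm
    ((MeasureTheory.volume.restrict e.target).withDensity
      fun y => ENNReal.ofReal (volDensity h e y))

/-- The Ricci form `-√-1 ∂∂̄ log det (h_{i j̄})`. -/
def ricci (h : Form11 n X) : Form11 n X :=
  fun e y => Matrix.of fun i j =>
    -dz (fun y' => dzbar (fun y'' => (Real.log (h e y'').det.re : ℂ)) j y') i y

/-- `ρ` is the Ricci potential of the Kähler form `ω`: `Ric(ω) - ω = √-1 ∂∂̄ ρ` and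
`∫ (e^ρ - 1) ωⁿ = 0`. As `Ric(ω)` represents `2π c₁(X)`, a Kähler form `ω` has a Ricci potential
if and only if `ω ∈ 2π c₁(X)`; then `X` is Fano. -/
structure IsRicciPotential [MeasurableSpace X] (h : Form11 n X) (ρ : X → ℝ) : Prop where
  smooth : SmoothReal n ρ
  eq : ∀ e ∈ atlas (Fin n → ℂ) X, ∀ y ∈ e.target, ricci h e y - h e y = ddbar ρ e y
  normalized : ∫ x, (Real.exp (ρ x) - 1) ∂(volMeasure h) = 0

end Manifold

/-! ### Compact tori of automorphisms and moment maps -/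

/-- A compact torus in `Aut(X)` with an identification with `(S¹)^r`: a faithful continuous action
of `(S¹)^r` on `X` by biholomorphic maps. -/
structure Torus (n r : ℕ) (X : Type*) [TopologicalSpace X] [ChartedSpace (Fin n → ℂ) X] where
  act : (Fin r → Circle) →* Equiv.Perm X
  injective : Function.Injective act
  continuous : Continuous fun p : (Fin r → Circle) × X => act p.1 p.2
  holomorphic : ∀ s, ContMDiff 𝓘(ℂ, Fin n → ℂ) 𝓘(ℂ, Fin n → ℂ) ω (act s)

section Torus

variable {n r : ℕ} {X : Type*} [TopologicalSpace X] [ChartedSpace (Fin n → ℂ) X]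

/-- `T` is not strictly contained in another compact torus of `Aut(X)`. -/
def Torus.IsMaximal (T : Torus n r X) : Prop :=
  ∀ (r' : ℕ) (T' : Torus n r' X), T.act.range ≤ T'.act.range → T'.act.range ≤ T.act.range

/-- The components `ξ_αⁱ` in the chart `e`, at the point `x`, of the holomorphic vector field
`ξ_α = ∑ ξ_αⁱ ∂/∂zⁱ` generating the action of the `α`-th factor of the complexified torus
`(ℂ^*)^r`. As `ξ_α` is the derivative of `c ↦ e^c · x` at `c = 0`, the circle action
`s ↦ e^{√-1 s} · x` has the derivative `√-1 ξ_α`. -/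
def Torus.generator (T : Torus n r X) (α : Fin r) (e : OpenPartialHomeomorph X (Fin n → ℂ))
    (x : X) (i : Fin n) : ℂ :=
  -Complex.I * deriv (fun s : ℝ => e (T.act (Pi.mulSingle α (Circle.exp s)) x) i) 0

/-- `μ = (θ₁, …, θ_r)` is the moment map of the form `ω`: `i_{ξ_α} ω = √-1 ∂̄ θ_α` and
`∫ θ_α ωⁿ = 0` for all `α`. -/
structure IsMomentMap [MeasurableSpace X] (T : Torus n r X) (h : Form11 n X)
    (μ : X → Fin r → ℝ) : Prop where
  smooth : ∀ α, SmoothReal n fun x => μ x α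
  hamilton : ∀ α, ∀ e ∈ atlas (Fin n → ℂ) X, ∀ y ∈ e.target, ∀ j : Fin n,
    ∑ i, h e y i j * T.generator α e (e.symm y) i = dzbar (fun y' => (μ (e.symm y') α : ℂ)) j y
  normalized : ∀ α, ∫ x, μ x α ∂(volMeasure h) = 0

/-- The space `𝓗(X, ω₀)^T` of `T`-invariant Kähler potentials: `ω_φ = ω₀ + √-1 ∂∂̄ φ > 0`. -/
structure IsKahlerPotential (T : Torus n r X) (ω₀ : Form11 n X) (φ : X → ℝ) : Prop where
  smooth : SmoothReal n φ
  positive : IsPositive (ω₀ + ddbar φ)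
  invariant : ∀ s x, φ (T.act s x) = φ x

/-- `g` is a smooth, positive and log concave function on the convex polytope `P`. -/
structure IsWeight (P : Set (Fin r → ℝ)) (g : (Fin r → ℝ) → ℝ) : Prop where
  smooth : ContDiffOn ℝ ∞ g P
  positive : ∀ p ∈ P, 0 < g p
  logConcave : ∀ p ∈ P, ∀ q ∈ P, ∀ a b : ℝ, 0 ≤ a → 0 ≤ b → a + b = 1 →
    g p ^ a * g q ^ b ≤ g (a • p + b • q)

end Torus

section Laplacian

variable {n : ℕ} {X : Type*} [TopologicalSpace X] [ChartedSpace (Fin n → ℂ) X]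

/-- The Monge-Ampère equation `G ω_φⁿ = e^{-tφ+ρ₀} ω₀ⁿ`, an equality of top degree forms; here
`G` stands for `g_φ`. -/
def SolvesContinuityEquation (ω₀ : Form11 n X) (ρ₀ : X → ℝ) (t : ℝ) (G φ : X → ℝ) : Prop :=
  ∀ e ∈ atlas (Fin n → ℂ) X, ∀ x ∈ e.source,
    G x * volDensity (ω₀ + ddbar φ) e (e x)
      = Real.exp (-t * φ x + ρ₀ x) * volDensity ω₀ e (e x)

/-- The `(0,1)`-form `∂̄ u`. -/
def dbar (u : X → ℂ) : Form01 n X :=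
  fun e y j => dzbar (fun y' => u (e.symm y')) j y

/-- The pointwise Hermitian inner product `⟨α, β⟩ = h^{i j̄} α_{j̄} conj(β_{ī})` of `(0,1)`-forms,
where `∑_j h^{i j̄} h_{k j̄} = δ_{ik}`, computed at `x` in the preferred chart. -/
def inner01 (h : Form11 n X) (α β : Form01 n X) (x : X) : ℂ :=
  let e := chartAt (Fin n → ℂ) x
  ∑ i, ∑ j, (h e (e x))⁻¹ j i * α e (e x) j * starRingEnd ℂ (β e (e x) i)

/-- `v = ∂̄^* α`, where `∂̄^*` is the formal adjoint of `∂̄` on functions with respect to the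
`L²` inner products defined by the Kähler form `h`. -/
def IsDbarAdjoint [MeasurableSpace X] (h : Form11 n X) (α : Form01 n X) (v : X → ℂ) : Prop :=
  SmoothComplex n v ∧ ∀ w : X → ℂ, SmoothComplex n w →
    ∫ x, v x * starRingEnd ℂ (w x) ∂(volMeasure h) = ∫ x, inner01 h α (dbar w) x ∂(volMeasure h)

/-- `v = -G⁻¹ ∂̄^*(G ∂̄ u)`, the `G`-twisted Laplacian of `u` with respect to the Kähler form `h`,
for a positive smooth function `G`. -/
def IsTwistedLaplacian [MeasurableSpace X] (h : Form11 n X) (G : X → ℝ) (u v : X → ℂ) : Prop :=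
  IsDbarAdjoint h (fun e y j => (G (e.symm y) : ℂ) * dbar u e y j) (fun x => -(G x : ℂ) * v x)

/-- `c` is an eigenvalue of the `G`-twisted Laplacian on `C^∞(X, ℂ)`. -/
def IsEigenvalue [MeasurableSpace X] (h : Form11 n X) (G : X → ℝ) (c : ℂ) : Prop :=
  ∃ u : X → ℂ, SmoothComplex n u ∧ u ≠ 0 ∧ IsTwistedLaplacian h G u (fun x => c * u x)

end Laplacian

end GSoliton

end

noncomputable section

namespace GSoliton

/-! ### Wirtinger calculus -/

section Wirtinger

variable {n : ℕ} {F G : (Fin n → ℂ) → ℂ} {i j : Fin n} {y : Fin n → ℂ}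
  {U : Set (Fin n → ℂ)}

/-! The argument is the weighted Bochner method. Put `Φ = -tφ + ρ₀ + log det ω₀` in each chart. The
Monge-Ampère equation says that the weighted volume `g_φ ω_φⁿ` is a constant multiple of `e^Φ` times
Lebesgue measure. The equation of the Ricci potential then gives its curvature: `-∂∂̄Φ = t ∂∂̄φ -
∂∂̄ρ₀ + Ric(ω₀) = t ω_φ + (1 - t) ω₀` (`isWeightPotential_of_solves`).

Let `u` be an eigenfunction with eigenvalue `c`, and let `V` be its gradient of type (1,0), defined
by `h V = ∂̄u`. Testing the weak eigenvalue equation against bump functions gives `div_Φ V = c u` in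
every chart (`IsWeightPotential.divergence_grad_eq`). Applying `∂̄` to this and contracting with the
conjugate of `V` yields `div_Φ (∇_{V̄} V) = (c + t) |V|²_{ω_φ} + (1 - t) |V|²_{ω₀} + tr (B B̄)`,
with `B = ∂̄V`. The last term is nonnegative because closedness of `ω_φ` makes `hᵀ B` symmetric. So
if `c + t ≥ 0`, the left side is nonnegative and vanishes only where `V` does (`divergence_nonneg`).

The field `∇_{V̄} V` is globally defined, since the Jacobians of the transition maps are
holomorphic. Hence its divergence integrates to zero over the compact manifold, which forces `V = 0`
(`IsWeightPotential.grad_eq_zero`). The identity `-c ∫ G |u|² = ∫ G |∂̄u|²` then gives `c = 0`. The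
same identity shows that every eigenvalue is real. -/

theorem dz_congr (hFG : F =ᶠ[nhds y] G) : dz F i y = dz G i y := by
  simp only [dz, hFG.fderiv_eq]

theorem dzbar_congr (hFG : F =ᶠ[nhds y] G) : dzbar F i y = dzbar G i y := by
  simp only [dzbar, hFG.fderiv_eq]

theorem dz_const (c : ℂ) : dz (fun _ => c) i y = 0 := by
  simp [dz]

theorem dz_add (hF : DifferentiableAt ℝ F y) (hG : DifferentiableAt ℝ G y) :
    dz (fun x => F x + G x) i y = dz F i y + dz G i y := by
  simp only [dz, fderiv_fun_add hF hG, _root_.add_apply]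
  ring

theorem dzbar_add (hF : DifferentiableAt ℝ F y) (hG : DifferentiableAt ℝ G y) :
    dzbar (fun x => F x + G x) i y = dzbar F i y + dzbar G i y := by
  simp only [dzbar, fderiv_fun_add hF hG, _root_.add_apply]
  ring

theorem dz_const_mul (c : ℂ) (hF : DifferentiableAt ℝ F y) :
    dz (fun x => c * F x) i y = c * dz F i y := by
  simp only [dz, fderiv_const_mul hF, _root_.smul_apply, smul_eq_mul]
  ring

theorem dzbar_const_mul (c : ℂ) (hF : DifferentiableAt ℝ F y) :
    dzbar (fun x => c * F x) i y = c * dzbar F i y := by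
  simp only [dzbar, fderiv_const_mul hF, _root_.smul_apply, smul_eq_mul]
  ring

theorem dz_mul (hF : DifferentiableAt ℝ F y) (hG : DifferentiableAt ℝ G y) :
    dz (fun x => F x * G x) i y = dz F i y * G y + F y * dz G i y := by
  simp only [dz, fderiv_fun_mul hF hG, _root_.add_apply,
    _root_.smul_apply, smul_eq_mul]
  ring

theorem dzbar_mul (hF : DifferentiableAt ℝ F y) (hG : DifferentiableAt ℝ G y) :
    dzbar (fun x => F x * G x) i y = dzbar F i y * G y + F y * dzbar G i y := by
  simp only [dzbar, fderiv_fun_mul hF hG, _root_.add_apply,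
    _root_.smul_apply, smul_eq_mul]
  ring

theorem dz_sum {ι : Type*} {s : Finset ι} {f : ι → (Fin n → ℂ) → ℂ}
    (hf : ∀ k ∈ s, DifferentiableAt ℝ (f k) y) :
    dz (fun x => ∑ k ∈ s, f k x) i y = ∑ k ∈ s, dz (f k) i y := by
  simp only [dz, fderiv_fun_sum hf, _root_.sum_apply, Finset.mul_sum,
    ← Finset.sum_sub_distrib]

theorem dzbar_sum {ι : Type*} {s : Finset ι} {f : ι → (Fin n → ℂ) → ℂ}
    (hf : ∀ k ∈ s, DifferentiableAt ℝ (f k) y) :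
    dzbar (fun x => ∑ k ∈ s, f k x) i y = ∑ k ∈ s, dzbar (f k) i y := by
  simp only [dzbar, fderiv_fun_sum hf, _root_.sum_apply, Finset.mul_sum,
    ← Finset.sum_add_distrib]

theorem fderiv_conj_apply (v : Fin n → ℂ) :
    fderiv ℝ (fun x => starRingEnd ℂ (F x)) y v = starRingEnd ℂ (fderiv ℝ F y v) := by
  have h := Complex.conjCLE.comp_fderiv (f := F) (x := y)
  have h2 : (fun x => starRingEnd ℂ (F x)) = Complex.conjCLE ∘ F := by
    ext x; simp
  rw [h2, h]
  simp

theorem dz_conj : dz (fun x => starRingEnd ℂ (F x)) i y = starRingEnd ℂ (dzbar F i y) := by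
  simp only [dz, dzbar, fderiv_conj_apply, map_mul, map_add, Complex.conj_I, map_div₀, map_one,
    map_ofNat]
  ring

theorem dzbar_conj : dzbar (fun x => starRingEnd ℂ (F x)) i y = starRingEnd ℂ (dz F i y) := by
  simp only [dz, dzbar, fderiv_conj_apply, map_mul, map_sub, Complex.conj_I, map_div₀, map_one,
    map_ofNat]
  ring

theorem conj_dzbar_ofReal (f : (Fin n → ℂ) → ℝ) :
    starRingEnd ℂ (dzbar (fun x => (f x : ℂ)) i y) = dz (fun x => (f x : ℂ)) i y := by
  rw [← dz_conj]; simp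

/-- The differential of a complex valued function in terms of its Wirtinger derivatives. -/
theorem fderiv_eq_sum_dz_dzbar (F : (Fin n → ℂ) → ℂ) (y v : Fin n → ℂ) :
    fderiv ℝ F y v = ∑ k, (dz F k y * v k + dzbar F k y * starRingEnd ℂ (v k)) := by
  have hv : v = ∑ k, ((v k).re • (Pi.single k 1 : Fin n → ℂ)
      + (v k).im • (Pi.single k Complex.I : Fin n → ℂ)) := by
    ext l
    simp only [Finset.sum_apply, Pi.add_apply, Pi.smul_apply, Pi.single_apply]
    simp [Finset.sum_add_distrib, Complex.re_add_im]
  conv_lhs => rw [hv]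
  rw [map_sum]
  refine Finset.sum_congr rfl fun k _ => ?_
  rw [← Complex.re_add_im (v k)]
  generalize (v k).re = a
  generalize (v k).im = b
  simp only [Complex.add_re, Complex.ofReal_re, Complex.mul_re, Complex.add_im, Complex.mul_im,
    Complex.I_re, Complex.I_im, Complex.ofReal_im, map_add, map_smul, dz, dzbar,
    Complex.real_smul, map_mul, Complex.conj_ofReal, Complex.conj_I, mul_zero, mul_one, sub_zero,
    add_zero, zero_add]
  linear_combination (fderiv ℝ F y (Pi.single k Complex.I) * b) * Complex.I_mul_I

theorem fderiv_real_eq_of_holomorphic (hF : DifferentiableAt ℂ F y) (v : Fin n → ℂ) :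
    fderiv ℝ F y v = fderiv ℂ F y v := by
  rw [hF.fderiv_restrictScalars ℝ]; rfl

theorem dzbar_of_holomorphic (hF : DifferentiableAt ℂ F y) : dzbar F i y = 0 := by
  have : (Pi.single i Complex.I : Fin n → ℂ) = Complex.I • Pi.single i 1 := by
    rw [← Pi.single_smul]; simp
  simp only [dzbar, fderiv_real_eq_of_holomorphic hF, this, map_smul, smul_eq_mul]
  rw [← mul_assoc, Complex.I_mul_I]
  ring

/-! ### Chain rule along holomorphic maps -/

section Chain

variable {τ : (Fin n → ℂ) → (Fin n → ℂ)}

theorem fderiv_comp_holomorphic (hF : DifferentiableAt ℝ F (τ y)) (hτ : DifferentiableAt ℂ τ y)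
    (v : Fin n → ℂ) :
    fderiv ℝ (fun x => F (τ x)) y v = fderiv ℝ F (τ y) (fderiv ℂ τ y v) := by
  have h := fderiv_comp y hF (hτ.restrictScalars ℝ)
  have h2 : fderiv ℝ (fun x => F (τ x)) y = _ := h
  rw [h2, hτ.fderiv_restrictScalars ℝ]
  rfl

theorem dz_comp_holomorphic (hF : DifferentiableAt ℝ F (τ y)) (hτ : DifferentiableAt ℂ τ y) :
    dz (fun x => F (τ x)) i y = ∑ k, dz F k (τ y) * fderiv ℂ τ y (Pi.single i 1) k := by
  have : (Pi.single i Complex.I : Fin n → ℂ) = Complex.I • Pi.single i 1 := by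
    rw [← Pi.single_smul]; simp
  rw [dz, fderiv_comp_holomorphic hF hτ, fderiv_comp_holomorphic hF hτ, this, map_smul,
    fderiv_eq_sum_dz_dzbar F (τ y), fderiv_eq_sum_dz_dzbar F (τ y), Finset.mul_sum,
    ← Finset.sum_sub_distrib, Finset.mul_sum]
  refine Finset.sum_congr rfl fun k _ => ?_
  simp only [Pi.smul_apply, smul_eq_mul, map_mul, Complex.conj_I]
  ring_nf
  simp
  ring

theorem dzbar_comp_holomorphic (hF : DifferentiableAt ℝ F (τ y)) (hτ : DifferentiableAt ℂ τ y) :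
    dzbar (fun x => F (τ x)) i y
      = ∑ k, dzbar F k (τ y) * starRingEnd ℂ (fderiv ℂ τ y (Pi.single i 1) k) := by
  have : (Pi.single i Complex.I : Fin n → ℂ) = Complex.I • Pi.single i 1 := by
    rw [← Pi.single_smul]; simp
  rw [dzbar, fderiv_comp_holomorphic hF hτ, fderiv_comp_holomorphic hF hτ, this, map_smul,
    fderiv_eq_sum_dz_dzbar F (τ y), fderiv_eq_sum_dz_dzbar F (τ y), Finset.mul_sum,
    ← Finset.sum_add_distrib, Finset.mul_sum]
  refine Finset.sum_congr rfl fun k _ => ?_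
  simp only [Pi.smul_apply, smul_eq_mul, map_mul, Complex.conj_I]
  ring_nf
  simp
  ring

end Chain

theorem dz_exp (hF : DifferentiableAt ℝ F y) :
    dz (fun x => Complex.exp (F x)) i y = Complex.exp (F y) * dz F i y := by
  have h : ∀ v, fderiv ℝ (fun x => Complex.exp (F x)) y v
      = Complex.exp (F y) * fderiv ℝ F y v := by
    intro v
    rw [hF.hasFDerivAt.cexp.fderiv]
    simp
  simp only [dz, h]
  ring

/-! ### Smoothness and commutation of Wirtinger derivatives -/

section Smooth

theorem differentiableAt_of_contDiffOn (hU : IsOpen U) (hF : ContDiffOn ℝ ∞ F U) (hy : y ∈ U) :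
    DifferentiableAt ℝ F y :=
  (hF.contDiffAt (hU.mem_nhds hy)).differentiableAt (by simp)

theorem contDiffOn_fderiv_apply (hU : IsOpen U) (hF : ContDiffOn ℝ ∞ F U) (v : Fin n → ℂ) :
    ContDiffOn ℝ ∞ (fun x => fderiv ℝ F x v) U :=
  (hF.fderiv_of_isOpen hU (m := ∞) (by simp)).clm_apply contDiffOn_const

theorem contDiffOn_dz (hU : IsOpen U) (hF : ContDiffOn ℝ ∞ F U) (i : Fin n) :
    ContDiffOn ℝ ∞ (dz F i) U :=
  contDiffOn_const.mul ((contDiffOn_fderiv_apply hU hF _).sub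
    (contDiffOn_const.mul (contDiffOn_fderiv_apply hU hF _)))

theorem contDiffOn_dzbar (hU : IsOpen U) (hF : ContDiffOn ℝ ∞ F U) (i : Fin n) :
    ContDiffOn ℝ ∞ (dzbar F i) U :=
  contDiffOn_const.mul ((contDiffOn_fderiv_apply hU hF _).add
    (contDiffOn_const.mul (contDiffOn_fderiv_apply hU hF _)))

theorem contDiffOn_conj (hF : ContDiffOn ℝ ∞ F U) :
    ContDiffOn ℝ ∞ (fun x => starRingEnd ℂ (F x)) U :=
  Complex.conjCLE.contDiff.comp_contDiffOn hF

theorem contDiffOn_ofReal {f : (Fin n → ℂ) → ℝ} (hf : ContDiffOn ℝ ∞ f U) :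
    ContDiffOn ℝ ∞ (fun x => (f x : ℂ)) U :=
  Complex.ofRealCLM.contDiff.comp_contDiffOn hf

theorem fderiv_fderiv_apply_comm (hU : IsOpen U) (hF : ContDiffOn ℝ ∞ F U) (hy : y ∈ U)
    (v w : Fin n → ℂ) :
    fderiv ℝ (fun x => fderiv ℝ F x v) y w = fderiv ℝ (fun x => fderiv ℝ F x w) y v := by
  have hFy := hF.contDiffAt (hU.mem_nhds hy)
  have hd : DifferentiableAt ℝ (fderiv ℝ F) y :=
    ((hF.fderiv_of_isOpen hU (m := ∞) (by simp)).contDiffAt (hU.mem_nhds hy)).differentiableAt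
      (by simp)
  have h (a b : Fin n → ℂ) :
      fderiv ℝ (fun x => fderiv ℝ F x a) y b = fderiv ℝ (fderiv ℝ F) y b a := by
    rw [fderiv_clm_apply hd (differentiableAt_const a)]
    simp
  rw [h, h]
  have h2 : minSmoothness ℝ 2 ≤ ∞ := by
    rw [minSmoothness_of_isRCLikeNormedField]
    exact WithTop.coe_le_coe.2 (le_top : (2 : ℕ∞) ≤ ⊤)
  exact (hFy.isSymmSndFDerivAt h2).eq w v

theorem fderiv_dz_apply (hU : IsOpen U) (hF : ContDiffOn ℝ ∞ F U) (hy : y ∈ U) (v : Fin n → ℂ) :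
    fderiv ℝ (dz F i) y v = (1 / 2) * (fderiv ℝ (fun x => fderiv ℝ F x (Pi.single i 1)) y v
      - Complex.I * fderiv ℝ (fun x => fderiv ℝ F x (Pi.single i Complex.I)) y v) := by
  have h (w : Fin n → ℂ) : DifferentiableAt ℝ (fun x => fderiv ℝ F x w) y :=
    differentiableAt_of_contDiffOn hU (contDiffOn_fderiv_apply hU hF w) hy
  unfold dz
  rw [fderiv_const_mul ((h _).fun_sub ((h _).const_mul _)),
    fderiv_fun_sub (h _) ((h _).const_mul _), fderiv_const_mul (h _)]
  simp

theorem fderiv_dzbar_apply (hU : IsOpen U) (hF : ContDiffOn ℝ ∞ F U) (hy : y ∈ U)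
    (v : Fin n → ℂ) :
    fderiv ℝ (dzbar F i) y v = (1 / 2) * (fderiv ℝ (fun x => fderiv ℝ F x (Pi.single i 1)) y v
      + Complex.I * fderiv ℝ (fun x => fderiv ℝ F x (Pi.single i Complex.I)) y v) := by
  have h (w : Fin n → ℂ) : DifferentiableAt ℝ (fun x => fderiv ℝ F x w) y :=
    differentiableAt_of_contDiffOn hU (contDiffOn_fderiv_apply hU hF w) hy
  unfold dzbar
  rw [fderiv_const_mul ((h _).fun_add ((h _).const_mul _)),
    fderiv_fun_add (h _) ((h _).const_mul _), fderiv_const_mul (h _)]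
  simp [mul_add]

theorem dz_dzbar_comm (hU : IsOpen U) (hF : ContDiffOn ℝ ∞ F U) (hy : y ∈ U) :
    dz (dzbar F j) i y = dzbar (dz F i) j y := by
  rw [dz, dzbar, fderiv_dzbar_apply hU hF hy, fderiv_dzbar_apply hU hF hy,
    fderiv_dz_apply hU hF hy, fderiv_dz_apply hU hF hy]
  simp only [fderiv_fderiv_apply_comm hU hF hy (Pi.single j _)]
  ring

theorem dz_dz_comm (hU : IsOpen U) (hF : ContDiffOn ℝ ∞ F U) (hy : y ∈ U) :
    dz (dz F j) i y = dz (dz F i) j y := by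
  rw [dz, dz, fderiv_dz_apply hU hF hy, fderiv_dz_apply hU hF hy,
    fderiv_dz_apply hU hF hy, fderiv_dz_apply hU hF hy]
  simp only [fderiv_fderiv_apply_comm hU hF hy (Pi.single j _)]
  ring

theorem dzbar_dzbar_comm (hU : IsOpen U) (hF : ContDiffOn ℝ ∞ F U) (hy : y ∈ U) :
    dzbar (dzbar F j) i y = dzbar (dzbar F i) j y := by
  rw [dzbar, dzbar, fderiv_dzbar_apply hU hF hy, fderiv_dzbar_apply hU hF hy,
    fderiv_dzbar_apply hU hF hy, fderiv_dzbar_apply hU hF hy]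
  simp only [fderiv_fderiv_apply_comm hU hF hy (Pi.single j _)]
  ring

end Smooth

end Wirtinger

/-! ### The Bochner identity in a coordinate domain -/

section Bochner

variable {n : ℕ} {U : Set (Fin n → ℂ)} {y : Fin n → ℂ}

/-- The divergence, with respect to the density `e^Φ`, of the derivative of the vector field
`V` of type `(1,0)` in the direction of its conjugate. -/
theorem divergence_conj_derivative {u Φ : (Fin n → ℂ) → ℂ} {V : Fin n → (Fin n → ℂ) → ℂ} {c : ℂ}
    (hU : IsOpen U) (hu : ContDiffOn ℝ ∞ u U) (hΦ : ContDiffOn ℝ ∞ Φ U)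
    (hV : ∀ i, ContDiffOn ℝ ∞ (V i) U)
    (heq : ∀ y ∈ U, ∑ l, (dz (V l) l y + dz Φ l y * V l y) = c * u y) (hy : y ∈ U) :
    ∑ l, (dz (fun y => ∑ j, starRingEnd ℂ (V j y) * dzbar (V l) j y) l y
        + dz Φ l y * ∑ j, starRingEnd ℂ (V j y) * dzbar (V l) j y)
      = ∑ j, starRingEnd ℂ (V j y) * (c * dzbar u j y - ∑ l, dz (dzbar Φ j) l y * V l y)
        + ∑ l, ∑ j, starRingEnd ℂ (dzbar (V j) l y) * dzbar (V l) j y := by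
  have hd {F : (Fin n → ℂ) → ℂ} (hF : ContDiffOn ℝ ∞ F U) : DifferentiableAt ℝ F y :=
    differentiableAt_of_contDiffOn hU hF hy
  have hVb (l j : Fin n) := contDiffOn_dzbar hU (hV l) j
  have hVz (l : Fin n) := contDiffOn_dz hU (hV l) l
  have hΦz (l : Fin n) := contDiffOn_dz hU hΦ l
  have h1 (l : Fin n) : dz (fun y => ∑ j, starRingEnd ℂ (V j y) * dzbar (V l) j y) l y
      = ∑ j, (starRingEnd ℂ (dzbar (V j) l y) * dzbar (V l) j y
        + starRingEnd ℂ (V j y) * dz (dzbar (V l) j) l y) := by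
    rw [dz_sum fun j _ => (hd (contDiffOn_conj (hV j))).fun_mul (hd (hVb l j))]
    refine Finset.sum_congr rfl fun j _ => ?_
    rw [dz_mul (hd (contDiffOn_conj (hV j))) (hd (hVb l j)), dz_conj]
  -- Apply `∂̄_j` to the eigenvalue equation and commute it past `∂_l`. This expresses the second
  -- derivatives `∂_l ∂̄_j V_l` from `h1` through `∂̄u` and the curvature of `Φ`.
  have h2 (j : Fin n) : c * dzbar u j y = ∑ l, (dz (dzbar (V l) j) l y
      + (dz (dzbar Φ j) l y * V l y + dz Φ l y * dzbar (V l) j y)) := by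
    rw [← dzbar_const_mul c (hd hu)]
    have : (fun x => c * u x) =ᶠ[nhds y] fun y => ∑ l, (dz (V l) l y + dz Φ l y * V l y) :=
      Filter.eventually_of_mem (hU.mem_nhds hy) fun x hx => (heq x hx).symm
    rw [dzbar_congr this,
      dzbar_sum fun l _ => (hd (hVz l)).fun_add ((hd (hΦz l)).fun_mul (hd (hV l)))]
    refine Finset.sum_congr rfl fun l _ => ?_
    rw [dzbar_add (hd (hVz l)) ((hd (hΦz l)).fun_mul (hd (hV l))),
      dzbar_mul (hd (hΦz l)) (hd (hV l)), dz_dzbar_comm hU (hV l) hy, dz_dzbar_comm hU hΦ hy]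
  simp only [h1, h2]
  simp only [← Finset.sum_sub_distrib, Finset.mul_sum]
  rw [Finset.sum_comm (γ := Fin n) (f := fun j l => starRingEnd ℂ (V j y) * _)]
  simp only [← Finset.sum_add_distrib]
  refine Finset.sum_congr rfl fun l _ => Finset.sum_congr rfl fun j _ => ?_
  ring

open scoped MatrixOrder in
/-- `tr (B B̄) ≥ 0` if `hᵀ B` is symmetric for a positive definite matrix `h`. -/
theorem sum_conj_mul_nonneg_of_symm {h B : Matrix (Fin n) (Fin n) ℂ} (hh : h.PosDef)
    (hB : (h.transpose * B).IsSymm) :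
    0 ≤ ∑ l, ∑ j, starRingEnd ℂ (B j l) * B l j := by
  obtain ⟨S, hS⟩ : ∃ S, S = h.transpose * B := ⟨_, rfl⟩
  have hu : IsUnit h.det := (Matrix.isUnit_iff_isUnit_det _).1 hh.isUnit
  have hut : IsUnit h.transpose.det := by rwa [Matrix.det_transpose]
  have hBS : B = (h⁻¹).transpose * S := by
    rw [hS, Matrix.transpose_nonsing_inv, Matrix.nonsing_inv_mul_cancel_left _ _ hut]
  -- Conjugating `S = hᵀ B` gives `S̄ = h B̄` as `h` is Hermitian, and `S̄ = S*` as `S` is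
  -- symmetric.
  have hBc : B.map (starRingEnd ℂ) = h⁻¹ * S.conjTranspose := by
    have h1 : S.conjTranspose = h * B.map (starRingEnd ℂ) := by
      rw [Matrix.conjTranspose, hS, hB.eq]
      conv_rhs => rw [← hh.isHermitian.eq]
      ext i j
      simp [Matrix.mul_apply]
    rw [h1, Matrix.nonsing_inv_mul_cancel_left _ _ hu]
  have htr : ∑ l, ∑ j, starRingEnd ℂ (B j l) * B l j = (B * B.map (starRingEnd ℂ)).trace := by
    simp [Matrix.trace, Matrix.mul_apply, mul_comm]
  -- Now `tr (B B̄) = tr ((h⁻¹)ᵀ S h⁻¹ S*)`. With `h⁻¹ = K* K` and `(h⁻¹)ᵀ = L* L`, this is the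
  -- squared Frobenius norm of `L S K*`.
  obtain ⟨K, hK⟩ := CStarAlgebra.nonneg_iff_eq_star_mul_self.mp hh.inv.posSemidef.nonneg
  obtain ⟨L, hL⟩ := CStarAlgebra.nonneg_iff_eq_star_mul_self.mp
    hh.inv.transpose.posSemidef.nonneg
  rw [htr, hBc]
  nth_rewrite 1 [hBS]
  rw [hL, hK, Matrix.star_eq_conjTranspose, Matrix.star_eq_conjTranspose]
  have : (L.conjTranspose * L * S * (K.conjTranspose * K * S.conjTranspose)).trace
      = ((L * S * K.conjTranspose) * (L * S * K.conjTranspose).conjTranspose).trace := by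
    rw [Matrix.mul_assoc L.conjTranspose, Matrix.mul_assoc L.conjTranspose, Matrix.trace_mul_comm]
    simp [Matrix.mul_assoc]
  rw [this]
  exact Matrix.PosSemidef.trace_nonneg (Matrix.posSemidef_self_mul_conjTranspose _)

/-- The hypothesis `hcl` is the (2,1) part of closedness. Since `h` is Hermitian, its conjugate is
the (1,2) part. -/
theorem dzbar_symm_of_closed {h : (Fin n → ℂ) → Matrix (Fin n) (Fin n) ℂ} (hU : IsOpen U)
    (hpos : ∀ y ∈ U, (h y).PosDef)
    (hcl : ∀ y ∈ U, ∀ i j k : Fin n, dz (fun y' => h y' i j) k y = dz (fun y' => h y' k j) i y)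
    (hy : y ∈ U) (i j k : Fin n) :
    dzbar (fun y' => h y' i j) k y = dzbar (fun y' => h y' i k) j y := by
  have h1 (j k : Fin n) :
      dzbar (fun y' => h y' i j) k y = starRingEnd ℂ (dz (fun y' => h y' j i) k y) := by
    rw [← dzbar_conj]
    refine dzbar_congr (Filter.eventually_of_mem (hU.mem_nhds hy) fun x hx => ?_)
    exact ((hpos x hx).isHermitian.apply i j).symm
  rw [h1, h1, hcl y hy]

/-- The covariant derivative of `∂̄u` of type `(0,2)` is symmetric. -/
theorem transpose_mul_dzbar_isSymm {h : (Fin n → ℂ) → Matrix (Fin n) (Fin n) ℂ}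
    {u : (Fin n → ℂ) → ℂ} {V : Fin n → (Fin n → ℂ) → ℂ} (hU : IsOpen U)
    (hpos : ∀ y ∈ U, (h y).PosDef)
    (hsm : ∀ i j : Fin n, ContDiffOn ℝ ∞ (fun y => h y i j) U)
    (hcl : ∀ y ∈ U, ∀ i j k : Fin n, dz (fun y' => h y' i j) k y = dz (fun y' => h y' k j) i y)
    (hu : ContDiffOn ℝ ∞ u U) (hV : ∀ i, ContDiffOn ℝ ∞ (V i) U)
    (hVu : ∀ y ∈ U, ∀ j, ∑ i, h y i j * V i y = dzbar u j y) (hy : y ∈ U) :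
    ((h y).transpose * Matrix.of fun l j => dzbar (V l) j y).IsSymm := by
  have hd {F : (Fin n → ℂ) → ℂ} (hF : ContDiffOn ℝ ∞ F U) : DifferentiableAt ℝ F y :=
    differentiableAt_of_contDiffOn hU hF hy
  -- Differentiating `h V = ∂̄u` gives `hᵀ ∂̄V = ∂̄∂̄u - (∂̄h) V`. Both terms on the right are
  -- symmetric in `j` and `k`, the second one by closedness.
  have key (j k : Fin n) : ∑ i, h y i j * dzbar (V i) k y
      = dzbar (dzbar u j) k y - ∑ i, dzbar (fun y' => h y' i j) k y * V i y := by
    have : dzbar u j =ᶠ[nhds y] fun y => ∑ i, h y i j * V i y :=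
      Filter.eventually_of_mem (hU.mem_nhds hy) fun x hx => (hVu x hx j).symm
    rw [dzbar_congr this, dzbar_sum fun i _ => (hd (hsm i j)).fun_mul (hd (hV i)),
      ← Finset.sum_sub_distrib]
    refine Finset.sum_congr rfl fun i _ => ?_
    rw [dzbar_mul (hd (hsm i j)) (hd (hV i))]
    ring
  ext j k
  simp only [Matrix.transpose_apply, Matrix.mul_apply, Matrix.of_apply]
  rw [key, key, dzbar_dzbar_comm hU hu hy]
  simp only [dzbar_symm_of_closed hU hpos hcl hy _ k j]

theorem sum_hermitian_pos {h : Matrix (Fin n) (Fin n) ℂ} (hh : h.PosDef) {v : Fin n → ℂ}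
    (hv : v ≠ 0) : 0 < ∑ l, ∑ j, h l j * v l * starRingEnd ℂ (v j) := by
  -- The sum has `v` in the unconjugated first slot, so the standard form `x* h x` is evaluated at
  -- `x = star v`.
  have h1 : star v ≠ 0 := by simpa using hv
  have h2 := hh.dotProduct_mulVec_pos h1
  refine h2.trans_eq ?_
  simp only [dotProduct, Matrix.mulVec, Finset.mul_sum, Pi.star_apply, star_star]
  refine Finset.sum_congr rfl fun l _ => Finset.sum_congr rfl fun j _ => ?_
  rw [RCLike.star_def]
  ring

theorem sum_hermitian_nonneg {h : Matrix (Fin n) (Fin n) ℂ} (hh : h.PosDef) (v : Fin n → ℂ) :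
    0 ≤ ∑ l, ∑ j, h l j * v l * starRingEnd ℂ (v j) := by
  rcases eq_or_ne v 0 with rfl | hv
  · simp
  · exact (sum_hermitian_pos hh hv).le

/-- The Bochner identity for the gradient field `V` of an eigenfunction `u`, with respect to the
density `e^Φ`, where `-√-1 ∂∂̄ Φ = t h + (1 - t) h₀`: if `c + t ≥ 0`, the divergence of the
derivative of `V` in the direction of its conjugate is nonnegative, and it vanishes only where
`V` does. -/
theorem divergence_nonneg {h h₀ : (Fin n → ℂ) → Matrix (Fin n) (Fin n) ℂ}
    {u Φ : (Fin n → ℂ) → ℂ} {V : Fin n → (Fin n → ℂ) → ℂ} {c t : ℝ}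
    (hU : IsOpen U) (hu : ContDiffOn ℝ ∞ u U) (hΦ : ContDiffOn ℝ ∞ Φ U)
    (hV : ∀ i, ContDiffOn ℝ ∞ (V i) U)
    (hpos : ∀ y ∈ U, (h y).PosDef) (hpos₀ : ∀ y ∈ U, (h₀ y).PosDef)
    (hsm : ∀ i j : Fin n, ContDiffOn ℝ ∞ (fun y => h y i j) U)
    (hcl : ∀ y ∈ U, ∀ i j k : Fin n, dz (fun y' => h y' i j) k y = dz (fun y' => h y' k j) i y)
    (hVu : ∀ y ∈ U, ∀ j, ∑ i, h y i j * V i y = dzbar u j y)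
    (hΦh : ∀ y ∈ U, ∀ l j, -dz (dzbar Φ j) l y = t * h y l j + (1 - t) * h₀ y l j)
    (heq : ∀ y ∈ U, ∑ l, (dz (V l) l y + dz Φ l y * V l y) = c * u y)
    (hct : 0 ≤ c + t) (ht : t < 1) (hy : y ∈ U) :
    0 ≤ ∑ l, (dz (fun y => ∑ j, starRingEnd ℂ (V j y) * dzbar (V l) j y) l y
        + dz Φ l y * ∑ j, starRingEnd ℂ (V j y) * dzbar (V l) j y) ∧
      (∑ l, (dz (fun y => ∑ j, starRingEnd ℂ (V j y) * dzbar (V l) j y) l y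
        + dz Φ l y * ∑ j, starRingEnd ℂ (V j y) * dzbar (V l) j y) = 0 → ∀ l, V l y = 0) := by
  have key : ∑ l, (dz (fun y => ∑ j, starRingEnd ℂ (V j y) * dzbar (V l) j y) l y
        + dz Φ l y * ∑ j, starRingEnd ℂ (V j y) * dzbar (V l) j y)
      = ((c + t : ℝ) : ℂ) * ∑ l, ∑ j, h y l j * V l y * starRingEnd ℂ (V j y)
        + ((1 - t : ℝ) : ℂ) * ∑ l, ∑ j, h₀ y l j * V l y * starRingEnd ℂ (V j y)
        + ∑ l, ∑ j, starRingEnd ℂ (dzbar (V j) l y) * dzbar (V l) j y := by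
    rw [divergence_conj_derivative hU hu hΦ hV heq hy]
    congr 1
    rw [Finset.sum_comm (f := fun l j => h y l j * _ * _),
      Finset.sum_comm (f := fun l j => h₀ y l j * _ * _), Finset.mul_sum, Finset.mul_sum,
      ← Finset.sum_add_distrib]
    refine Finset.sum_congr rfl fun j _ => ?_
    -- Replace `∂̄_j u` by `∑ h_{l j̄} V_l`. The term `c ∂̄u` then contributes `c h`, which joins
    -- the `t h` coming from the curvature.
    rw [← hVu y hy j, Finset.mul_sum, Finset.mul_sum, Finset.mul_sum, ← Finset.sum_sub_distrib,
      Finset.mul_sum, ← Finset.sum_add_distrib]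
    refine Finset.sum_congr rfl fun l _ => ?_
    push_cast
    linear_combination (starRingEnd ℂ (V j y) * V l y) * hΦh y hy l j
  have hA := sum_hermitian_nonneg (hpos y hy) fun l => V l y
  have hB := sum_hermitian_nonneg (hpos₀ y hy) fun l => V l y
  have hC := sum_conj_mul_nonneg_of_symm (hpos y hy)
    (transpose_mul_dzbar_isSymm hU hpos hsm hcl hu hV hVu hy)
  simp only [Matrix.of_apply] at hC
  have hct' : (0 : ℂ) ≤ ((c + t : ℝ) : ℂ) := by exact_mod_cast hct
  have ht' : (0 : ℂ) < ((1 - t : ℝ) : ℂ) := by exact_mod_cast sub_pos.2 ht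
  rw [key]
  refine ⟨add_nonneg (add_nonneg (mul_nonneg hct' hA) (mul_nonneg ht'.le hB)) hC, fun h0 => ?_⟩
  by_contra! hne
  have hv : (fun l => V l y) ≠ 0 := fun h => hne.elim fun l hl => hl (congrFun h l)
  -- Strict positivity comes from the `(1 - t) h₀` term alone, so the borderline case `c + t = 0` is
  -- covered.
  exact (add_pos_of_pos_of_nonneg (add_pos_of_nonneg_of_pos (mul_nonneg hct' hA)
    (mul_pos ht' (sum_hermitian_pos (hpos₀ y hy) hv))) hC).ne' h0

end Bochner

/-! ### Integration by parts in a coordinate domain -/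

section Integration

open MeasureTheory

variable {n : ℕ} {U K : Set (Fin n → ℂ)} {F : (Fin n → ℂ) → ℂ}

/-- `U` and the complement of `K` form an open cover. The extension by zero agrees with `F` on the
first set and with `0` on the second. -/
theorem contDiff_indicator_of_vanish (hU : IsOpen U) (hK : IsCompact K) (hKU : K ⊆ U)
    (hF : ContDiffOn ℝ ∞ F U) (hF0 : ∀ y ∈ U, y ∉ K → F y = 0) :
    ContDiff ℝ ∞ (U.indicator F) := by
  rw [contDiff_iff_contDiffAt]
  intro y
  by_cases hy : y ∈ U
  · refine (hF.contDiffAt (hU.mem_nhds hy)).congr_of_eventuallyEq ?_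
    filter_upwards [hU.mem_nhds hy] with x hx
    exact Set.indicator_of_mem hx F
  · have hyK : y ∈ Kᶜ := fun h => hy (hKU h)
    refine (contDiffAt_const (c := (0 : ℂ))).congr_of_eventuallyEq ?_
    filter_upwards [hK.isClosed.isOpen_compl.mem_nhds hyK] with x hx
    by_cases hxU : x ∈ U
    · rw [Set.indicator_of_mem hxU, hF0 x hxU hx]
    · rw [Set.indicator_of_notMem hxU]

theorem hasCompactSupport_indicator_of_vanish (hK : IsCompact K)
    (hF0 : ∀ y ∈ U, y ∉ K → F y = 0) : HasCompactSupport (U.indicator F) := by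
  refine HasCompactSupport.intro hK fun x hx => ?_
  by_cases hxU : x ∈ U
  · rw [Set.indicator_of_mem hxU, hF0 x hxU hx]
  · rw [Set.indicator_of_notMem hxU]

theorem integral_fderiv_apply_eq_zero (hF : ContDiff ℝ ∞ F) (hFc : HasCompactSupport F)
    (v : Fin n → ℂ) : ∫ y, fderiv ℝ F y v = 0 := by
  have hint : Integrable (fun y => fderiv ℝ F y v) :=
    (((hF.fderiv_right (m := ∞) (by simp)).continuous).clm_apply
      continuous_const).integrable_of_hasCompactSupport (hFc.fderiv_apply ℝ v)
  -- Integration by parts against the constant function `1`.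
  have h := integral_mul_fderiv_eq_neg_fderiv_mul_of_integrable (𝕜 := ℂ)
    (μ := (volume : Measure (Fin n → ℂ))) (f := fun _ => (1 : ℂ)) (g := F) (v := v)
    (by simp) (by simpa using hint)
    (by simpa using hF.continuous.integrable_of_hasCompactSupport hFc)
    (fun _ _ => differentiableAt_const _) (fun x _ => hF.differentiable (by simp) x)
  simpa using h

theorem integral_dz_eq_zero (hU : IsOpen U) (hK : IsCompact K) (hKU : K ⊆ U)
    (hF : ContDiffOn ℝ ∞ F U) (hF0 : ∀ y ∈ U, y ∉ K → F y = 0) (i : Fin n) :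
    ∫ y in U, dz F i y = 0 := by
  have hG := contDiff_indicator_of_vanish hU hK hKU hF hF0
  have hGc := hasCompactSupport_indicator_of_vanish hK hF0
  have hint (v : Fin n → ℂ) : Integrable (fun y => fderiv ℝ (U.indicator F) y v) :=
    (((hG.fderiv_right (m := ∞) (by simp)).continuous).clm_apply
      continuous_const).integrable_of_hasCompactSupport (hGc.fderiv_apply ℝ v)
  have h1 : ∀ y ∈ U, dz F i y = dz (U.indicator F) i y := fun y hy => by
    refine dz_congr ?_
    filter_upwards [hU.mem_nhds hy] with x hx
    exact (Set.indicator_of_mem hx F).symm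
  have h2 : ∀ y ∉ U, dz (U.indicator F) i y = 0 := fun y hy => by
    have hyK : y ∈ Kᶜ := fun h => hy (hKU h)
    rw [← dz_const (i := i) (y := y) 0]
    refine dz_congr ?_
    filter_upwards [hK.isClosed.isOpen_compl.mem_nhds hyK] with x hx
    by_cases hxU : x ∈ U
    · rw [Set.indicator_of_mem hxU, hF0 x hxU hx]
    · rw [Set.indicator_of_notMem hxU]
  rw [setIntegral_congr_fun hU.measurableSet h1,
    setIntegral_eq_integral_of_forall_compl_eq_zero h2]
  simp only [dz]
  rw [integral_const_mul, integral_sub (hint _) ((hint _).const_mul _), integral_const_mul,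
    integral_fderiv_apply_eq_zero hG hGc, integral_fderiv_apply_eq_zero hG hGc]
  simp

/-- A function which is continuous on an open set and vanishes outside of a compact subset is
integrable on the open set. -/
theorem integrableOn_of_vanish (hU : IsOpen U) (hK : IsCompact K) (hKU : K ⊆ U)
    (hF : ContinuousOn F U) (hF0 : ∀ y ∈ U, y ∉ K → F y = 0) : IntegrableOn F U := by
  have h1 : IntegrableOn F K := (hF.mono hKU).integrableOn_compact hK
  have h2 : IntegrableOn F (U \ K) :=
    integrableOn_zero.congr_fun (fun y hy => (hF0 y hy.1 hy.2).symm)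
      (hU.measurableSet.diff hK.measurableSet)
  exact (h1.union h2).mono_set fun y hy => by
    by_cases hyK : y ∈ K
    · exact Or.inl hyK
    · exact Or.inr ⟨hy, hyK⟩

/-- The divergence theorem for the vector field `χ W` with respect to the density `e^Φ`. -/
theorem integral_divergence_eq_zero {Φ χ : (Fin n → ℂ) → ℂ} {W : Fin n → (Fin n → ℂ) → ℂ}
    (hU : IsOpen U) (hK : IsCompact K) (hKU : K ⊆ U) (hΦ : ContDiffOn ℝ ∞ Φ U)
    (hχ : ContDiffOn ℝ ∞ χ U) (hW : ∀ l, ContDiffOn ℝ ∞ (W l) U)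
    (hχ0 : ∀ y ∈ U, y ∉ K → χ y = 0) :
    (∫ y in U, Complex.exp (Φ y) * (χ y * ∑ l, (dz (W l) l y + dz Φ l y * W l y)))
      + ∫ y in U, Complex.exp (Φ y) * ∑ l, W l y * dz χ l y = 0 := by
  have hΦe : ContDiffOn ℝ ∞ (fun y => Complex.exp (Φ y)) U := hΦ.cexp
  have hdiv : ContDiffOn ℝ ∞ (fun y => ∑ l, (dz (W l) l y + dz Φ l y * W l y)) U :=
    ContDiffOn.sum fun l _ => (contDiffOn_dz hU (hW l) l).add ((contDiffOn_dz hU hΦ l).mul (hW l))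
  have hWχ : ContDiffOn ℝ ∞ (fun y => ∑ l, W l y * dz χ l y) U :=
    ContDiffOn.sum fun l _ => (hW l).mul (contDiffOn_dz hU hχ l)
  have hdχ0 (l : Fin n) : ∀ y ∈ U, y ∉ K → dz χ l y = 0 := fun y hy hyK => by
    rw [← dz_const (i := l) (y := y) 0]
    refine dz_congr ?_
    filter_upwards [hU.mem_nhds hy, hK.isClosed.isOpen_compl.mem_nhds hyK] with x hx hxK
    exact hχ0 x hx hxK
  have hF (l : Fin n) : ContDiffOn ℝ ∞ (fun y => Complex.exp (Φ y) * (χ y * W l y)) U :=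
    hΦe.mul (hχ.mul (hW l))
  have hF0 (l : Fin n) : ∀ y ∈ U, y ∉ K → Complex.exp (Φ y) * (χ y * W l y) = 0 :=
    fun y hy hyK => by simp [hχ0 y hy hyK]
  rw [← integral_add
    (integrableOn_of_vanish hU hK hKU (hΦe.mul (hχ.mul hdiv)).continuousOn
      fun y hy hyK => by simp [hχ0 y hy hyK])
    (integrableOn_of_vanish hU hK hKU (hΦe.mul hWχ).continuousOn
      fun y hy hyK => by simp [hdχ0 _ y hy hyK])]
  -- Leibniz rule: the two integrands add up to the divergence of the field `e^Φ χ W`, which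
  -- vanishes outside `K`.
  have key : ∀ y ∈ U, Complex.exp (Φ y) * (χ y * ∑ l, (dz (W l) l y + dz Φ l y * W l y))
      + Complex.exp (Φ y) * ∑ l, W l y * dz χ l y
      = ∑ l, dz (fun y => Complex.exp (Φ y) * (χ y * W l y)) l y := fun y hy => by
    have hd {F : (Fin n → ℂ) → ℂ} (hF : ContDiffOn ℝ ∞ F U) : DifferentiableAt ℝ F y :=
      differentiableAt_of_contDiffOn hU hF hy
    simp only [Finset.mul_sum]
    rw [← Finset.sum_add_distrib]
    refine Finset.sum_congr rfl fun l _ => ?_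
    rw [dz_mul (hd hΦe) (hd (hχ.mul (hW l))), dz_mul (hd hχ) (hd (hW l)), dz_exp (hd hΦ)]
    ring
  rw [setIntegral_congr_fun hU.measurableSet key, integral_finsetSum]
  · exact Finset.sum_eq_zero fun l _ => integral_dz_eq_zero hU hK hKU (hF l) (hF0 l) l
  · intro l _
    refine integrableOn_of_vanish hU hK hKU (contDiffOn_dz hU (hF l) l).continuousOn ?_
    intro y hy hyK
    rw [← dz_const (i := l) (y := y) 0]
    refine dz_congr ?_
    filter_upwards [hU.mem_nhds hy, hK.isClosed.isOpen_compl.mem_nhds hyK] with x hx hxK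
    exact hF0 l x hx hxK

end Integration

/-! ### Changes of holomorphic coordinates -/

section Coordinates

variable {n : ℕ} {X : Type*} [TopologicalSpace X]

/-- The Jacobian matrix of the change of coordinates between two charts. -/
def jac (e e' : OpenPartialHomeomorph X (Fin n → ℂ)) (y : Fin n → ℂ) :
    Matrix (Fin n) (Fin n) ℂ :=
  Matrix.of fun k i => fderiv ℂ (fun y => e' (e.symm y)) y (Pi.single i 1) k

variable {e e' : OpenPartialHomeomorph X (Fin n → ℂ)} {y : Fin n → ℂ}

theorem mem_overlap (hy : y ∈ (e.symm ≫ₕ e').source) :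
    y ∈ e.target ∧ e.symm y ∈ e'.source := by
  simpa using hy

theorem overlap_mem_nhds (hy : y ∈ (e.symm ≫ₕ e').source) :
    (e.symm ≫ₕ e').source ∈ nhds y :=
  (e.symm ≫ₕ e').open_source.mem_nhds hy

theorem transition_mem_target (hy : y ∈ (e.symm ≫ₕ e').source) : e' (e.symm y) ∈ e'.target :=
  e'.map_source (mem_overlap hy).2

theorem symm_transition (hy : y ∈ (e.symm ≫ₕ e').source) : e'.symm (e' (e.symm y)) = e.symm y :=
  e'.left_inv (mem_overlap hy).2

theorem transition_mem_overlap (hy : y ∈ (e.symm ≫ₕ e').source) :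
    e' (e.symm y) ∈ (e'.symm ≫ₕ e).source := by
  have h := symm_transition hy
  simp only [OpenPartialHomeomorph.trans_source, OpenPartialHomeomorph.symm_source,
    Set.mem_inter_iff, Set.mem_preimage]
  refine ⟨transition_mem_target hy, ?_⟩
  rw [h]
  exact e.map_target (mem_overlap hy).1

variable [ChartedSpace (Fin n → ℂ) X]

theorem preservedBy_id_apply {h : Form11 n X} (hh : PreservedBy id h)
    (he : e ∈ atlas (Fin n → ℂ) X) (he' : e' ∈ atlas (Fin n → ℂ) X)
    (hy : y ∈ (e.symm ≫ₕ e').source) :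
    h e y = (jac e e' y).transpose * h e' (e' (e.symm y)) * (jac e e' y).map (starRingEnd ℂ) := by
  have hy' := mem_overlap hy
  ext i j
  have := hh e he e' he' (e.symm y) (e.map_target hy'.1) hy'.2 i j
  rw [e.right_inv hy'.1] at this
  rw [this]
  simp only [id, Matrix.mul_apply, Matrix.transpose_apply, Matrix.map_apply, Finset.sum_mul, jac,
    Matrix.of_apply]
  rw [Finset.sum_comm]
  refine Finset.sum_congr rfl fun k _ => Finset.sum_congr rfl fun l _ => ?_
  ring

/-! ### Holomorphic transition maps and transformation laws -/

section Holomorphic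

variable [IsManifold 𝓘(ℂ, Fin n → ℂ) ω X]

theorem contDiffOn_transition (he : e ∈ atlas (Fin n → ℂ) X) (he' : e' ∈ atlas (Fin n → ℂ) X) :
    ContDiffOn ℂ ω (fun y => e' (e.symm y)) (e.symm ≫ₕ e').source := by
  have h := (contDiffGroupoid ω 𝓘(ℂ, Fin n → ℂ)).compatible he he'
  rw [contDiffGroupoid, mem_groupoid_of_pregroupoid] at h
  simpa [contDiffPregroupoid, Function.comp_def] using h.1

theorem differentiableAt_transition (he : e ∈ atlas (Fin n → ℂ) X)
    (he' : e' ∈ atlas (Fin n → ℂ) X) (hy : y ∈ (e.symm ≫ₕ e').source) :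
    DifferentiableAt ℂ (fun y => e' (e.symm y)) y :=
  ((contDiffOn_transition he he').contDiffAt (overlap_mem_nhds hy)).differentiableAt (by simp)

theorem differentiableAt_jac (he : e ∈ atlas (Fin n → ℂ) X)
    (he' : e' ∈ atlas (Fin n → ℂ) X) (hy : y ∈ (e.symm ≫ₕ e').source) (k i : Fin n) :
    DifferentiableAt ℂ (fun y => jac e e' y k i) y := by
  have h1 : ContDiffOn ℂ ω (fderiv ℂ (fun y => e' (e.symm y))) (e.symm ≫ₕ e').source :=
    (contDiffOn_transition he he').fderiv_of_isOpen (e.symm ≫ₕ e').open_source (by simp)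
  have h2 := ((h1.contDiffAt (overlap_mem_nhds hy)).differentiableAt (by simp)).clm_apply
    (differentiableAt_const (Pi.single i (1 : ℂ)))
  exact differentiableAt_pi.1 h2 k

-- Smooth functions, bump functions and partitions of unity live on the underlying real manifold.
-- Transition maps analytic over `ℂ` are smooth over `ℝ`.
variable (n X) in
theorem isManifold_real : IsManifold 𝓘(ℝ, Fin n → ℂ) ∞ X := by
  refine isManifold_of_contDiffOn _ _ _ fun e e' he he' => ?_
  have h := ((contDiffOn_transition he he').restrict_scalars ℝ).of_le (m := ∞) le_top
  simpa [Function.comp_def] using h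

theorem jac_mul_jac (he : e ∈ atlas (Fin n → ℂ) X)
    (he' : e' ∈ atlas (Fin n → ℂ) X) (hy : y ∈ (e.symm ≫ₕ e').source) :
    jac e' e (e' (e.symm y)) * jac e e' y = 1 := by
  have h1 := differentiableAt_transition he he' hy
  have h2 := differentiableAt_transition he' he (transition_mem_overlap hy)
  have h3 : (fun z => e (e'.symm z)) ∘ (fun y => e' (e.symm y)) =ᶠ[nhds y] id := by
    filter_upwards [overlap_mem_nhds hy] with z hz
    simp only [Function.comp, symm_transition hz, id]
    exact e.right_inv (mem_overlap hz).1
  have h4 := fderiv_comp y h2 h1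
  rw [h3.fderiv_eq, fderiv_id] at h4
  ext k i
  have h5 := congrFun (congrArg (fun L => L (Pi.single i (1 : ℂ))) h4) k
  simp only [ContinuousLinearMap.id_apply, ContinuousLinearMap.comp_apply] at h5
  rw [Matrix.one_apply]
  rw [Pi.single_apply] at h5
  rw [h5, ← Finset.univ_sum_single (fderiv ℂ (fun y => e' (e.symm y)) y (Pi.single i 1)),
    map_sum, Finset.sum_apply, Matrix.mul_apply]
  refine Finset.sum_congr rfl fun l _ => ?_
  have h6 : ∀ a : ℂ, (Pi.single l a : Fin n → ℂ) = a • Pi.single l 1 := fun a => by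
    rw [← Pi.single_smul]; simp
  rw [h6, map_smul]
  simp [jac, mul_comm]

theorem isUnit_det_jac (he : e ∈ atlas (Fin n → ℂ) X)
    (he' : e' ∈ atlas (Fin n → ℂ) X) (hy : y ∈ (e.symm ≫ₕ e').source) :
    IsUnit (jac e e' y).det := by
  have h := congrArg Matrix.det (jac_mul_jac he he' hy)
  rw [Matrix.det_mul, Matrix.det_one, mul_comm] at h
  exact IsUnit.of_mul_eq_one _ h

theorem contDiffOn_comp_symm {F : Type*} [NormedAddCommGroup F] [NormedSpace ℝ F] {f : X → F}
    (hf : ContMDiff 𝓘(ℝ, Fin n → ℂ) 𝓘(ℝ, F) ∞ f) (he : e ∈ atlas (Fin n → ℂ) X) :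
    ContDiffOn ℝ ∞ (fun y => f (e.symm y)) e.target := by
  have := isManifold_real n X
  have h := contMDiffOn_symm_of_mem_maximalAtlas
    (IsManifold.subset_maximalAtlas (I := 𝓘(ℝ, Fin n → ℂ)) (n := ∞) he)
  exact (hf.comp_contMDiffOn h).contDiffOn

theorem dz_transform {f : X → ℂ} (hf : SmoothComplex n f) (he : e ∈ atlas (Fin n → ℂ) X)
    (he' : e' ∈ atlas (Fin n → ℂ) X) (hy : y ∈ (e.symm ≫ₕ e').source) (i : Fin n) :
    dz (fun y => f (e.symm y)) i y
      = ∑ k, dz (fun y => f (e'.symm y)) k (e' (e.symm y)) * jac e e' y k i := by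
  rw [jac]
  simp only [Matrix.of_apply]
  rw [← dz_comp_holomorphic (τ := fun y => e' (e.symm y))
    (differentiableAt_of_contDiffOn e'.open_target (contDiffOn_comp_symm hf he')
      (transition_mem_target hy)) (differentiableAt_transition he he' hy)]
  refine dz_congr ?_
  filter_upwards [overlap_mem_nhds hy] with z hz
  rw [symm_transition hz]

theorem dzbar_transform {f : X → ℂ} (hf : SmoothComplex n f) (he : e ∈ atlas (Fin n → ℂ) X)
    (he' : e' ∈ atlas (Fin n → ℂ) X) (hy : y ∈ (e.symm ≫ₕ e').source) (i : Fin n) :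
    dzbar (fun y => f (e.symm y)) i y
      = ∑ k, dzbar (fun y => f (e'.symm y)) k (e' (e.symm y)) * starRingEnd ℂ (jac e e' y k i) := by
  rw [jac]
  simp only [Matrix.of_apply]
  rw [← dzbar_comp_holomorphic (τ := fun y => e' (e.symm y))
    (differentiableAt_of_contDiffOn e'.open_target (contDiffOn_comp_symm hf he')
      (transition_mem_target hy)) (differentiableAt_transition he he' hy)]
  refine dzbar_congr ?_
  filter_upwards [overlap_mem_nhds hy] with z hz
  rw [symm_transition hz]

/-- The components of `√-1 ∂∂̄ f` satisfy the transformation law of a `(1,1)`-form. -/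
theorem preservedBy_id_ddbar {f : X → ℝ} (hf : SmoothReal n f) :
    PreservedBy id (ddbar f : Form11 n X) := by
  have hfc : SmoothComplex n fun x => (f x : ℂ) :=
    Complex.ofRealCLM.contDiff.contMDiff.comp hf
  intro e he e' he' x hx hx' i j
  obtain ⟨y, hy, rfl⟩ : ∃ y, y ∈ (e.symm ≫ₕ e').source ∧ e.symm y = x := by
    refine ⟨e x, ?_, e.left_inv hx⟩
    simpa [e.map_source hx, e.left_inv hx] using hx'
  have hy' := mem_overlap hy
  rw [e.right_inv hy'.1]
  have hτ := differentiableAt_transition he he' hy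
  have hd (l : Fin n) : DifferentiableAt ℝ (dzbar (fun y => (f (e'.symm y) : ℂ)) l)
      (e' (e.symm y)) :=
    differentiableAt_of_contDiffOn e'.open_target
      (contDiffOn_dzbar e'.open_target (contDiffOn_comp_symm hfc he') l)
      (transition_mem_target hy)
  have hdτ (l : Fin n) : DifferentiableAt ℝ
      (fun y => dzbar (fun y => (f (e'.symm y) : ℂ)) l (e' (e.symm y))) y :=
    DifferentiableAt.comp (g := dzbar (fun y => (f (e'.symm y) : ℂ)) l)
      (f := fun y => e' (e.symm y)) y (hd l) (hτ.restrictScalars ℝ)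
  have hdJ (l : Fin n) : DifferentiableAt ℝ (fun y => starRingEnd ℂ (jac e e' y l j)) y :=
    Complex.conjCLE.differentiableAt.comp y
      ((differentiableAt_jac he he' hy l j).restrictScalars ℝ)
  have h1 : dzbar (fun y => (f (e.symm y) : ℂ)) j =ᶠ[nhds y] fun y =>
      ∑ l, dzbar (fun y => (f (e'.symm y) : ℂ)) l (e' (e.symm y))
        * starRingEnd ℂ (jac e e' y l j) := by
    filter_upwards [overlap_mem_nhds hy] with z hz
    exact dzbar_transform hfc he he' hz j
  simp only [ddbar, Matrix.of_apply]
  change dz (dzbar (fun y => (f (e.symm y) : ℂ)) j) i y = _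
  rw [dz_congr h1, dz_sum fun l _ => (hdτ l).fun_mul (hdJ l), Finset.sum_comm]
  refine Finset.sum_congr rfl fun l _ => ?_
  -- The conjugate Jacobian is antiholomorphic, so `∂_i` annihilates it and no second derivatives of
  -- the transition map appear.
  rw [dz_mul (hdτ l) (hdJ l), dz_conj,
    dzbar_of_holomorphic (differentiableAt_jac he he' hy l j), map_zero, mul_zero, add_zero,
    dz_comp_holomorphic (hd l) hτ, Finset.sum_mul]
  rfl

end Holomorphic

theorem preservedBy_add {F : X → X} {h h' : Form11 n X} (hh : PreservedBy F h)
    (hh' : PreservedBy F h') : PreservedBy F (h + h') := by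
  intro e he e' he' x hx hx' i j
  simp only [Pi.add_apply, Matrix.add_apply]
  rw [hh e he e' he' x hx hx' i j, hh' e he e' he' x hx hx' i j]
  simp only [add_mul, Finset.sum_add_distrib]

/-- Adding `√-1 ∂∂̄ f` to a Kähler form gives a Kähler form if the sum is positive. -/
theorem isKahler_add_ddbar [IsManifold 𝓘(ℂ, Fin n → ℂ) ω X] {h : Form11 n X} (hh : IsKahler h)
    {f : X → ℝ} (hf : SmoothReal n f) (hpos : IsPositive (h + ddbar f)) :
    IsKahler (h + ddbar f) where
  transform := preservedBy_add hh.transform (preservedBy_id_ddbar hf)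
  smooth e he i j := by
    have hfe := contDiffOn_ofReal (contDiffOn_comp_symm hf he)
    exact (hh.smooth e he i j).add
      (contDiffOn_dz e.open_target (contDiffOn_dzbar e.open_target hfe j) i)
  positive := hpos
  closed e he y hy i j k := by
    have hfe := contDiffOn_ofReal (contDiffOn_comp_symm hf he)
    have hd {F : (Fin n → ℂ) → ℂ} (hF : ContDiffOn ℝ ∞ F e.target) : DifferentiableAt ℝ F y :=
      differentiableAt_of_contDiffOn e.open_target hF hy
    have hb := contDiffOn_dzbar e.open_target hfe j
    have h1 (i k : Fin n) : dz (fun y' => (h + ddbar f : Form11 n X) e y' i j) k y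
        = dz (fun y' => h e y' i j) k y
          + dz (dz (dzbar (fun y => (f (e.symm y) : ℂ)) j) i) k y :=
      dz_add (hd (hh.smooth e he i j)) (hd (contDiffOn_dz e.open_target hb i))
    rw [h1, h1, hh.closed e he y hy, dz_dz_comm e.open_target hb hy]

end Coordinates

/-! ### The gradient field of type `(1,0)` of a function -/

section Gradient

theorem contDiffOn_det {n m : ℕ} {A : (Fin n → ℂ) → Matrix (Fin m) (Fin m) ℂ}
    {U : Set (Fin n → ℂ)} (hA : ∀ i j, ContDiffOn ℝ ∞ (fun y => A y i j) U) :
    ContDiffOn ℝ ∞ (fun y => (A y).det) U := by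
  simp only [Matrix.det_apply']
  exact ContDiffOn.sum fun σ _ => contDiffOn_const.mul (contDiffOn_prod fun i _ => hA _ _)

theorem contDiffOn_inv {n m : ℕ} {A : (Fin n → ℂ) → Matrix (Fin m) (Fin m) ℂ}
    {U : Set (Fin n → ℂ)} (hA : ∀ i j, ContDiffOn ℝ ∞ (fun y => A y i j) U)
    (hdet : ∀ y ∈ U, (A y).det ≠ 0) (i j : Fin m) :
    ContDiffOn ℝ ∞ (fun y => (A y)⁻¹ i j) U := by
  simp only [Matrix.inv_def, Matrix.smul_apply, Matrix.adjugate_apply, Ring.inverse_eq_inv',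
    smul_eq_mul]
  refine ((contDiffOn_det hA).inv hdet).mul (contDiffOn_det fun k l => ?_)
  by_cases hk : k = j
  · subst hk
    simpa using contDiffOn_const
  · simpa [Matrix.updateRow_ne hk] using hA k l

variable {n : ℕ} {X : Type*} [TopologicalSpace X]

/-- The components `h^{i j̄} ∂_{j̄} u` of the gradient of `u` in the chart `e`. -/
def grad (h : Form11 n X) (u : X → ℂ) (e : OpenPartialHomeomorph X (Fin n → ℂ)) (i : Fin n)
    (y : Fin n → ℂ) : ℂ :=
  Matrix.vecMul (fun j => dzbar (fun y' => u (e.symm y')) j y) (h e y)⁻¹ i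

/-- The components of the derivative of the gradient of `u` in the direction of its conjugate. -/
def conjDerivGrad (h : Form11 n X) (u : X → ℂ) (e : OpenPartialHomeomorph X (Fin n → ℂ))
    (l : Fin n) (y : Fin n → ℂ) : ℂ :=
  ∑ j, starRingEnd ℂ (grad h u e j y) * dzbar (grad h u e l) j y

variable [ChartedSpace (Fin n → ℂ) X] {h : Form11 n X} {u w : X → ℂ}
  {e e' : OpenPartialHomeomorph X (Fin n → ℂ)} {y : Fin n → ℂ}

theorem isUnit_det_of_isPositive (hh : IsPositive h) (he : e ∈ atlas (Fin n → ℂ) X)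
    (hy : y ∈ e.target) : IsUnit (h e y).det :=
  (Matrix.isUnit_iff_isUnit_det _).1 (hh e he y hy).isUnit

theorem sum_mul_grad (hh : IsPositive h) (he : e ∈ atlas (Fin n → ℂ) X)
    (hy : y ∈ e.target) (j : Fin n) :
    ∑ i, h e y i j * grad h u e i y = dzbar (fun y' => u (e.symm y')) j y := by
  have h1 : Matrix.vecMul (fun i => grad h u e i y) (h e y)
      = fun j => dzbar (fun y' => u (e.symm y')) j y := by
    change Matrix.vecMul (Matrix.vecMul _ _) _ = _
    rw [Matrix.vecMul_vecMul, Matrix.nonsing_inv_mul _ (isUnit_det_of_isPositive hh he hy),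
      Matrix.vecMul_one]
  rw [← congrFun h1 j]
  simp [Matrix.vecMul, dotProduct, mul_comm]

theorem inner01_dbar (G : X → ℝ) (x : X) :
    inner01 h (fun e y j => (G (e.symm y) : ℂ) * dbar u e y j) (dbar w) x
      = G x * ∑ i, grad h u (chartAt (Fin n → ℂ) x) i (chartAt (Fin n → ℂ) x x)
        * starRingEnd ℂ
          (dzbar (fun y => w ((chartAt (Fin n → ℂ) x).symm y)) i (chartAt (Fin n → ℂ) x x)) := by
  simp only [inner01, dbar, grad, Matrix.vecMul, dotProduct, Finset.mul_sum, Finset.sum_mul,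
    (chartAt (Fin n → ℂ) x).left_inv (mem_chart_source _ x)]
  refine Finset.sum_congr rfl fun i _ => Finset.sum_congr rfl fun j _ => ?_
  ring

/-- In a chart, the inner product of `∂̄u` with itself is the Hermitian norm of the gradient. -/
theorem sum_grad_mul_conj_dzbar (hh : IsPositive h) (he : e ∈ atlas (Fin n → ℂ) X)
    (hy : y ∈ e.target) :
    ∑ i, grad h u e i y * starRingEnd ℂ (dzbar (fun y => u (e.symm y)) i y)
      = ∑ l, ∑ j, h e y l j * grad h u e l y * starRingEnd ℂ (grad h u e j y) := by
  refine Finset.sum_congr rfl fun i _ => ?_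
  rw [← sum_mul_grad hh he hy i, map_sum, Finset.mul_sum]
  refine Finset.sum_congr rfl fun j _ => ?_
  rw [map_mul, starRingEnd_apply (h e y j i), (hh e he y hy).isHermitian.apply i j]
  ring

variable [IsManifold 𝓘(ℂ, Fin n → ℂ) ω X]

theorem contDiffOn_grad (hh : IsKahler h) (hu : SmoothComplex n u)
    (he : e ∈ atlas (Fin n → ℂ) X) (i : Fin n) : ContDiffOn ℝ ∞ (grad h u e i) e.target := by
  change ContDiffOn ℝ ∞ (fun y => ∑ j, dzbar (fun y' => u (e.symm y')) j y * (h e y)⁻¹ j i) _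
  exact ContDiffOn.sum fun j _ =>
    (contDiffOn_dzbar e.open_target (contDiffOn_comp_symm hu he) j).mul
      (contDiffOn_inv (hh.smooth e he)
        (fun _ hy => (isUnit_det_of_isPositive hh.positive he hy).ne_zero) j i)

theorem contDiffOn_conjDerivGrad (hh : IsKahler h) (hu : SmoothComplex n u)
    (he : e ∈ atlas (Fin n → ℂ) X) (l : Fin n) :
    ContDiffOn ℝ ∞ (conjDerivGrad h u e l) e.target :=
  ContDiffOn.sum fun j _ => (contDiffOn_conj (contDiffOn_grad hh hu he j)).mul
    (contDiffOn_dzbar e.open_target (contDiffOn_grad hh hu he l) j)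

/-- Insert the transformation laws `∂̄u = (∂̄u)' J̄` and `h = Jᵀ h' J̄` into `V h = ∂̄u`. Cancelling
`J̄` and then `h'` leaves `V' = J V`. -/
theorem grad_transform (hh : IsKahler h) (hu : SmoothComplex n u)
    (he : e ∈ atlas (Fin n → ℂ) X) (he' : e' ∈ atlas (Fin n → ℂ) X)
    (hy : y ∈ (e.symm ≫ₕ e').source) (k : Fin n) :
    grad h u e' k (e' (e.symm y)) = ∑ i, jac e e' y k i * grad h u e i y := by
  have hJ : IsUnit ((jac e e' y).map (starRingEnd ℂ)).det := by
    have := (isUnit_det_jac he he' hy).map (starRingEnd ℂ)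
    rwa [RingHom.map_det] at this
  have hu' := isUnit_det_of_isPositive hh.positive he' (transition_mem_target hy)
  have hV : Matrix.vecMul (fun i => grad h u e i y) (h e y)
      = fun j => dzbar (fun y' => u (e.symm y')) j y := by
    ext j
    rw [← sum_mul_grad hh.positive he (mem_overlap hy).1 j]
    simp [Matrix.vecMul, dotProduct, mul_comm]
  have hb : (fun j => dzbar (fun y' => u (e.symm y')) j y)
      = Matrix.vecMul (fun j => dzbar (fun y' => u (e'.symm y')) j (e' (e.symm y)))
        ((jac e e' y).map (starRingEnd ℂ)) := by
    ext j
    rw [dzbar_transform hu he he' hy j]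
    simp [Matrix.vecMul, dotProduct]
  rw [hb, preservedBy_id_apply hh.transform he he' hy, ← Matrix.vecMul_vecMul,
    ← Matrix.vecMul_vecMul] at hV
  have h2 := congrArg (fun v => Matrix.vecMul (Matrix.vecMul v
    ((jac e e' y).map (starRingEnd ℂ))⁻¹) (h e' (e' (e.symm y)))⁻¹) hV
  simp only [Matrix.vecMul_vecMul, Matrix.mul_nonsing_inv _ hJ, Matrix.mul_one, Matrix.mul_assoc,
    Matrix.one_mul, Matrix.mul_nonsing_inv _ hu'] at h2
  rw [Matrix.vecMul_transpose] at h2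
  exact (congrFun h2 k).symm

/-- The entries of `J` are holomorphic, so `∂̄` of `V' = J V` falls on `V` only. Hence `∂̄V` is a
tensor without any connection terms, and contracting it with `V̄` gives a global field of type
(1,0). -/
theorem conjDerivGrad_transform (hh : IsKahler h) (hu : SmoothComplex n u)
    (he : e ∈ atlas (Fin n → ℂ) X) (he' : e' ∈ atlas (Fin n → ℂ) X)
    (hy : y ∈ (e.symm ≫ₕ e').source) (k : Fin n) :
    conjDerivGrad h u e' k (e' (e.symm y)) = ∑ l, jac e e' y k l * conjDerivGrad h u e l y := by
  have h1 : (fun y => grad h u e' k (e' (e.symm y))) =ᶠ[nhds y]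
      fun y => ∑ i, jac e e' y k i * grad h u e i y := by
    filter_upwards [overlap_mem_nhds hy] with z hz
    exact grad_transform hh hu he he' hz k
  have hJ (i : Fin n) := differentiableAt_jac he he' hy k i
  have hV (i : Fin n) : DifferentiableAt ℝ (grad h u e i) y :=
    differentiableAt_of_contDiffOn e.open_target (contDiffOn_grad hh hu he i) (mem_overlap hy).1
  have key (j : Fin n) : ∑ m, dzbar (grad h u e' k) m (e' (e.symm y))
        * starRingEnd ℂ (jac e e' y m j)
      = ∑ i, jac e e' y k i * dzbar (grad h u e i) j y := by
    have h2 := dzbar_comp_holomorphic (i := j) (τ := fun y => e' (e.symm y))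
      (differentiableAt_of_contDiffOn e'.open_target (contDiffOn_grad hh hu he' k)
        (transition_mem_target hy)) (differentiableAt_transition he he' hy)
    rw [dzbar_congr h1, dzbar_sum fun i _ => ((hJ i).restrictScalars ℝ).fun_mul (hV i)] at h2
    refine h2.symm.trans (Finset.sum_congr rfl fun i _ => ?_)
    rw [dzbar_mul ((hJ i).restrictScalars ℝ) (hV i), dzbar_of_holomorphic (hJ i)]
    ring
  simp only [conjDerivGrad, grad_transform hh hu he he' hy, map_sum, map_mul, Finset.sum_mul,
    Finset.mul_sum]
  rw [Finset.sum_comm, Finset.sum_comm (f := fun l j => jac e e' y k l * _)]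
  refine Finset.sum_congr rfl fun j _ => ?_
  have h3 := congrArg (fun z => starRingEnd ℂ (grad h u e j y) * z) (key j)
  simp only [Finset.mul_sum] at h3
  refine Eq.trans (Finset.sum_congr rfl fun m _ => ?_)
    (h3.trans (Finset.sum_congr rfl fun l _ => ?_)) <;> ring


/-- The derivative of a function along a vector field of type `(1,0)` does not depend on the
chart. -/
theorem sum_mul_dz_transform {v v' : Fin n → ℂ} (hw : SmoothComplex n w)
    (he : e ∈ atlas (Fin n → ℂ) X) (he' : e' ∈ atlas (Fin n → ℂ) X)
    (hy : y ∈ (e.symm ≫ₕ e').source) (hv : ∀ k, v' k = ∑ i, jac e e' y k i * v i) :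
    ∑ k, v' k * dz (fun y => w (e'.symm y)) k (e' (e.symm y))
      = ∑ i, v i * dz (fun y => w (e.symm y)) i y := by
  simp only [dz_transform hw he he' hy, hv, Finset.sum_mul, Finset.mul_sum]
  rw [Finset.sum_comm]
  refine Finset.sum_congr rfl fun i _ => Finset.sum_congr rfl fun k _ => ?_
  ring

end Gradient

/-! ### The volume measure of a Kähler form -/

section Volume

open MeasureTheory

/-! ### The volume density in coordinates -/

section Density

variable {n : ℕ} {X : Type*} [TopologicalSpace X] [ChartedSpace (Fin n → ℂ) X] {h : Form11 n X}
  {e e' : OpenPartialHomeomorph X (Fin n → ℂ)}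

theorem volDensity_pos (hh : IsPositive h) (he : e ∈ atlas (Fin n → ℂ) X) {y : Fin n → ℂ}
    (hy : y ∈ e.target) : 0 < volDensity h e y := by
  have := (Complex.pos_iff.1 (hh e he y hy).det_pos).1
  unfold volDensity
  positivity

theorem contDiffOn_volDensity (hh : IsKahler h) (he : e ∈ atlas (Fin n → ℂ) X) :
    ContDiffOn ℝ ∞ (volDensity h e) e.target :=
  contDiffOn_const.mul (Complex.reCLM.contDiff.comp_contDiffOn (contDiffOn_det (hh.smooth e he)))

/-- The real determinant of a complex linear map is the squared modulus of its complex determinant.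
This is the factor `det J · conj (det J)` acquired by `det h`. -/
theorem volDensity_transform [IsManifold 𝓘(ℂ, Fin n → ℂ) ω X] (hh : IsKahler h)
    (he : e ∈ atlas (Fin n → ℂ) X) (he' : e' ∈ atlas (Fin n → ℂ) X)
    {y : Fin n → ℂ} (hy : y ∈ (e.symm ≫ₕ e').source) :
    volDensity h e y
      = |((fderiv ℂ (fun y => e' (e.symm y)) y).restrictScalars ℝ).det|
        * volDensity h e' (e' (e.symm y)) := by
  have h1 : ((fderiv ℂ (fun y => e' (e.symm y)) y).restrictScalars ℝ).det
      = Complex.normSq (jac e e' y).det := by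
    have h2 : jac e e' y
        = LinearMap.toMatrix' (fderiv ℂ (fun y => e' (e.symm y)) y).toLinearMap := by
      ext k i
      rw [LinearMap.toMatrix'_apply]
      simp [jac]
    rw [h2, LinearMap.det_toMatrix', ← Algebra.norm_complex_apply, ← LinearMap.det_restrictScalars]
    rfl
  rw [h1, abs_of_nonneg (Complex.normSq_nonneg _), volDensity, volDensity,
    preservedBy_id_apply hh.transform he he' hy, Matrix.det_mul, Matrix.det_mul,
    Matrix.det_transpose]
  have h3 : ((jac e e' y).map (starRingEnd ℂ)).det = starRingEnd ℂ (jac e e' y).det := by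
    rw [RingHom.map_det]; rfl
  rw [h3, mul_right_comm (jac e e' y).det, Complex.mul_conj, Complex.re_ofReal_mul]
  ring

end Density

variable {n : ℕ} {X : Type*} [TopologicalSpace X] [MeasurableSpace X]

/-- The measure on the domain of the chart `e` defined by the volume form of `h`. -/
def chartMeasure (h : Form11 n X) (e : OpenPartialHomeomorph X (Fin n → ℂ)) : Measure X :=
  Measure.map e.symm ((volume.restrict e.target).withDensity
    fun y => ENNReal.ofReal (volDensity h e y))

theorem volMeasure_eq_iSup [ChartedSpace (Fin n → ℂ) X] (h : Form11 n X) :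
    volMeasure h = ⨆ e ∈ atlas (Fin n → ℂ) X, chartMeasure h e := rfl

variable [BorelSpace X] {h : Form11 n X} {e e' : OpenPartialHomeomorph X (Fin n → ℂ)}

theorem aemeasurable_symm :
    AEMeasurable e.symm ((volume.restrict e.target).withDensity
      fun y => ENNReal.ofReal (volDensity h e y)) :=
  (e.continuousOn_symm.aemeasurable e.open_target.measurableSet).mono_ac
    (withDensity_absolutelyContinuous _ _)

theorem chartMeasure_apply {A : Set X} (hA : MeasurableSet A) :
    chartMeasure h e A
      = ∫⁻ y in e.target ∩ e.symm ⁻¹' A, ENNReal.ofReal (volDensity h e y) := by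
  rw [chartMeasure, Measure.map_apply_of_aemeasurable aemeasurable_symm hA, withDensity_apply',
    Measure.restrict_restrict' e.open_target.measurableSet, Set.inter_comm]

theorem chartMeasure_compl_source : chartMeasure h e e.sourceᶜ = 0 := by
  rw [chartMeasure_apply e.open_source.measurableSet.compl]
  have : e.target ∩ e.symm ⁻¹' e.sourceᶜ = ∅ := by
    ext y
    simp only [Set.mem_inter_iff, Set.mem_preimage, Set.mem_compl_iff, Set.mem_empty_iff_false,
      iff_false, not_and, not_not]
    exact fun hy => e.map_target hy
  rw [this, Measure.restrict_empty, lintegral_zero_measure]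

theorem measurableSet_target_inter_preimage {A : Set X} (hA : MeasurableSet A) :
    MeasurableSet (e.target ∩ e.symm ⁻¹' A) := by
  have h1 : Measurable (e.target.domRestrict e.symm) :=
    (continuousOn_iff_continuous_domRestrict.1 e.continuousOn_symm).measurable
  have h2 := (MeasurableEmbedding.subtype_coe e.open_target.measurableSet).measurableSet_image'
    (h1 hA)
  convert h2 using 1
  ext y
  simp [Set.domRestrict_apply, and_comm]

variable [ChartedSpace (Fin n → ℂ) X]

variable [IsManifold 𝓘(ℂ, Fin n → ℂ) ω X]

theorem chartMeasure_eq_of_subset (hh : IsKahler h) (he : e ∈ atlas (Fin n → ℂ) X)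
    (he' : e' ∈ atlas (Fin n → ℂ) X) {A : Set X} (hA : MeasurableSet A) (hAe : A ⊆ e.source)
    (hAe' : A ⊆ e'.source) : chartMeasure h e A = chartMeasure h e' A := by
  rw [chartMeasure_apply hA, chartMeasure_apply hA]
  have hsub : e.target ∩ e.symm ⁻¹' A ⊆ (e.symm ≫ₕ e').source := fun y hy => by
    simpa using ⟨hy.1, hAe' hy.2⟩
  have himg : e'.target ∩ e'.symm ⁻¹' A
      = (fun y => e' (e.symm y)) '' (e.target ∩ e.symm ⁻¹' A) := by
    ext z
    constructor
    · rintro ⟨hz, hzA⟩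
      refine ⟨e (e'.symm z), ⟨e.map_source (hAe hzA), ?_⟩, ?_⟩
      · simpa [e.left_inv (hAe hzA)] using hzA
      · simp [e.left_inv (hAe hzA), e'.right_inv hz]
    · rintro ⟨y, hy, rfl⟩
      refine ⟨transition_mem_target (hsub hy), ?_⟩
      simpa [symm_transition (hsub hy)] using hy.2
  rw [himg, lintegral_image_eq_lintegral_abs_det_fderiv_mul volume
    (measurableSet_target_inter_preimage hA)
    (f' := fun y => (fderiv ℂ (fun y => e' (e.symm y)) y).restrictScalars ℝ)]
  · refine setLIntegral_congr_fun (measurableSet_target_inter_preimage hA) fun y hy => ?_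
    rw [volDensity_transform hh he he' (hsub hy), ENNReal.ofReal_mul (abs_nonneg _)]
  · intro y hy
    exact ((differentiableAt_transition he he' (hsub hy)).hasFDerivAt.restrictScalars
      ℝ).hasFDerivWithinAt
  · exact (e.symm ≫ₕ e').injOn.mono hsub

theorem volMeasure_apply_of_subset (hh : IsKahler h) (he : e ∈ atlas (Fin n → ℂ) X)
    {A : Set X} (hA : MeasurableSet A) (hAe : A ⊆ e.source) :
    volMeasure h A = chartMeasure h e A := by
  have hs := e.open_source.measurableSet
  refine le_antisymm ?_ ?_
  -- A measure that dominates every chart measure, hence their supremum. On subsets of `e.source`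
  -- its second summand vanishes, so there it reduces to the measure of the chart `e`.
  · have hle : volMeasure h ≤ chartMeasure h e + (volMeasure h).restrict e.sourceᶜ := by
      conv_lhs => rw [volMeasure_eq_iSup]
      refine iSup₂_le fun e' he' => Measure.le_iff.2 fun B hB => ?_
      rw [← measure_inter_add_sdiff B hs, Measure.add_apply, Measure.restrict_apply hB,
        ← Set.sdiff_eq]
      refine add_le_add ?_ ?_
      · have hB' := hB.inter hs
        rw [← measure_inter_add_sdiff _ e'.open_source.measurableSet]
        have h0 : chartMeasure h e' ((B ∩ e.source) \ e'.source) = 0 :=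
          measure_mono_null (fun x hx => hx.2) chartMeasure_compl_source
        rw [h0, add_zero, chartMeasure_eq_of_subset hh he' he
          (hB'.inter e'.open_source.measurableSet) Set.inter_subset_right
          (Set.inter_subset_left.trans Set.inter_subset_right)]
        exact measure_mono (Set.inter_subset_left.trans Set.inter_subset_left)
      · exact le_iSup₂ (f := fun e _ => chartMeasure h e) e' he' _
    refine (hle A).trans_eq ?_
    rw [Measure.add_apply, Measure.restrict_apply hA, ← Set.sdiff_eq, Set.sdiff_eq_empty.2 hAe]
    simp
  · exact le_iSup₂ (f := fun e _ => chartMeasure h e) e he _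

theorem volMeasure_restrict_source (hh : IsKahler h) (he : e ∈ atlas (Fin n → ℂ) X) :
    (volMeasure h).restrict e.source = chartMeasure h e := by
  ext A hA
  have hs := e.open_source.measurableSet
  rw [Measure.restrict_apply hA, volMeasure_apply_of_subset hh he (hA.inter hs)
    Set.inter_subset_right, ← measure_inter_add_sdiff A hs]
  have h0 : chartMeasure h e (A \ e.source) = 0 :=
    measure_mono_null (fun x hx => hx.2) chartMeasure_compl_source
  rw [h0, add_zero]

/-- Integrals of functions supported in the domain of a chart, in the coordinates. -/
theorem integral_volMeasure_eq (hh : IsKahler h) (he : e ∈ atlas (Fin n → ℂ) X) {F : X → ℂ}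
    (hF : ContinuousOn F e.source) (hF0 : ∀ x ∉ e.source, F x = 0) :
    ∫ x, F x ∂(volMeasure h) = ∫ y in e.target, (volDensity h e y : ℂ) * F (e.symm y) := by
  have hm : AEStronglyMeasurable F (chartMeasure h e) := by
    rw [← volMeasure_restrict_source hh he]
    exact hF.aestronglyMeasurable e.open_source.measurableSet
  rw [← setIntegral_eq_integral_of_forall_compl_eq_zero hF0, volMeasure_restrict_source hh he,
    chartMeasure, integral_map aemeasurable_symm hm,
    integral_withDensity_eq_integral_toReal_smul₀]
  · refine setIntegral_congr_fun e.open_target.measurableSet fun y hy => ?_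
    rw [ENNReal.toReal_ofReal (volDensity_pos hh.positive he hy).le, Complex.real_smul]
  · exact ((contDiffOn_volDensity hh he).continuousOn.aemeasurable
      e.open_target.measurableSet).ennreal_ofReal
  · simp

theorem isOpenPosMeasure_volMeasure (hh : IsKahler h) : (volMeasure h).IsOpenPosMeasure := by
  refine ⟨fun O hO ⟨x, hx⟩ h0 => ?_⟩
  set e := chartAt (Fin n → ℂ) x
  have he : e ∈ atlas (Fin n → ℂ) X := chart_mem_atlas _ x
  have hxe : x ∈ e.source := mem_chart_source _ x
  have hOe := (hO.inter e.open_source).measurableSet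
  have h1 : volMeasure h (O ∩ e.source) = 0 := measure_mono_null Set.inter_subset_left h0
  rw [volMeasure_apply_of_subset hh he hOe Set.inter_subset_right, chartMeasure_apply hOe,
    setLIntegral_eq_zero_iff' (measurableSet_target_inter_preimage hOe)] at h1
  · have h2 : volume (e.target ∩ e.symm ⁻¹' (O ∩ e.source)) = 0 := by
      refine measure_mono_null (fun y hy => ?_) (ae_iff.1 h1)
      intro hy'
      have := volDensity_pos hh.positive he hy.1
      have h3 := hy' hy
      simp only [ENNReal.ofReal_eq_zero] at h3
      exact absurd h3 (not_le.2 this)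
    have h3 : IsOpen (e.target ∩ e.symm ⁻¹' (O ∩ e.source)) :=
      e.continuousOn_symm.isOpen_inter_preimage e.open_target (hO.inter e.open_source)
    refine (h3.measure_pos volume ⟨e x, e.map_source hxe, ?_⟩).ne' h2
    simpa [e.left_inv hxe] using ⟨hx, hxe⟩
  · exact (((contDiffOn_volDensity hh he).continuousOn.mono Set.inter_subset_left).aemeasurable
      (measurableSet_target_inter_preimage hOe)).ennreal_ofReal

theorem isFiniteMeasure_volMeasure [CompactSpace X] (hh : IsKahler h) :
    IsFiniteMeasure (volMeasure h) := by
  have : IsLocallyFiniteMeasure (volMeasure h) := by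
    refine ⟨fun x => ?_⟩
    set e := chartAt (Fin n → ℂ) x
    have he : e ∈ atlas (Fin n → ℂ) X := chart_mem_atlas _ x
    have hxe : x ∈ e.source := mem_chart_source _ x
    obtain ⟨K, hKc, hxK, hKe⟩ := exists_compact_subset e.open_target (e.map_source hxe)
    have hO : IsOpen (e.source ∩ e ⁻¹' interior K) :=
      e.continuousOn.isOpen_inter_preimage e.open_source isOpen_interior
    refine ⟨_, hO.mem_nhds ⟨hxe, hxK⟩, ?_⟩
    rw [volMeasure_apply_of_subset hh he hO.measurableSet Set.inter_subset_left,
      chartMeasure_apply hO.measurableSet]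
    refine lt_of_le_of_lt (lintegral_mono_set (t := K) ?_)
      (((contDiffOn_volDensity hh he).continuousOn.mono hKe).integrableOn_compact
        hKc).lintegral_lt_top
    rintro y ⟨hy, -, hyK⟩
    have := interior_subset hyK
    rwa [e.right_inv hy] at this
  exact CompactSpace.isFiniteMeasure

end Volume

/-! ### Integration by parts on the manifold -/

section GlobalIntegration

open MeasureTheory

theorem continuousOn_source_of_comp_symm {n : ℕ} {X : Type*}
    [TopologicalSpace X] {e : OpenPartialHomeomorph X (Fin n → ℂ)} {F : Type*}
    [TopologicalSpace F] {f : X → F} (hf : ContinuousOn (fun y => f (e.symm y)) e.target) :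
    ContinuousOn f e.source := by
  refine (hf.comp e.continuousOn e.mapsTo).congr fun x hx => ?_
  simp [e.left_inv hx]

theorem tsupport_ofReal {X : Type*} [TopologicalSpace X] (f : X → ℝ) :
    tsupport (fun x => (f x : ℂ)) = tsupport f := by
  simp [tsupport, Function.support]

variable {n : ℕ} {X : Type*} [TopologicalSpace X] [ChartedSpace (Fin n → ℂ) X]

/-- `v e i y` are the components in the chart `e` of a smooth vector field of type `(1,0)`. -/
structure IsVectorField (v : OpenPartialHomeomorph X (Fin n → ℂ) → Fin n → (Fin n → ℂ) → ℂ) :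
    Prop where
  smooth : ∀ e ∈ atlas (Fin n → ℂ) X, ∀ i, ContDiffOn ℝ ∞ (v e i) e.target
  transform : ∀ e ∈ atlas (Fin n → ℂ) X, ∀ e' ∈ atlas (Fin n → ℂ) X,
    ∀ y ∈ (e.symm ≫ₕ e').source, ∀ k, v e' k (e' (e.symm y)) = ∑ i, jac e e' y k i * v e i y

/-- The derivative of `w` along the vector field `v` of type `(1,0)`. -/
def vecDeriv (v : OpenPartialHomeomorph X (Fin n → ℂ) → Fin n → (Fin n → ℂ) → ℂ) (w : X → ℂ)
    (x : X) : ℂ :=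
  ∑ i, v (chartAt (Fin n → ℂ) x) i (chartAt (Fin n → ℂ) x x)
    * dz (fun y => w ((chartAt (Fin n → ℂ) x).symm y)) i (chartAt (Fin n → ℂ) x x)

/-- The function `G` is the density of `e^Φ` with respect to `hⁿ` in each chart, up to a
constant, and the curvature form `-√-1 ∂∂̄ Φ` is `t h + (1 - t) h₀`. -/
structure IsWeightPotential (h h₀ : Form11 n X) (G : X → ℝ) (t : ℝ)
    (Φ : OpenPartialHomeomorph X (Fin n → ℂ) → (Fin n → ℂ) → ℝ) : Prop where
  smooth : ∀ e ∈ atlas (Fin n → ℂ) X, ContDiffOn ℝ ∞ (Φ e) e.target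
  density : ∀ e ∈ atlas (Fin n → ℂ) X, ∀ y ∈ e.target,
    G (e.symm y) * volDensity h e y = (n.factorial : ℝ) * 2 ^ n * Real.exp (Φ e y)
  curvature : ∀ e ∈ atlas (Fin n → ℂ) X, ∀ y ∈ e.target, ∀ l j,
    -dz (dzbar (fun y => (Φ e y : ℂ)) j) l y = t * h e y l j + (1 - t) * h₀ e y l j

variable {h h₀ : Form11 n X} {G : X → ℝ} {t : ℝ}
  {Φ : OpenPartialHomeomorph X (Fin n → ℂ) → (Fin n → ℂ) → ℝ}
  {v : OpenPartialHomeomorph X (Fin n → ℂ) → Fin n → (Fin n → ℂ) → ℂ} {u w : X → ℂ}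
  {e : OpenPartialHomeomorph X (Fin n → ℂ)}

theorem continuous_of_comp_symm {F : Type*} [TopologicalSpace F] {f : X → F}
    (hf : ∀ e ∈ atlas (Fin n → ℂ) X, ContinuousOn (fun y => f (e.symm y)) e.target) :
    Continuous f :=
  continuous_iff_continuousAt.2 fun x =>
    (continuousOn_source_of_comp_symm (hf _ (chart_mem_atlas _ x))).continuousAt
      ((chartAt (Fin n → ℂ) x).open_source.mem_nhds (mem_chart_source _ x))

theorem vecDeriv_eq_zero {x : X} (hw : x ∉ tsupport w) : vecDeriv v w x = 0 := by
  refine Finset.sum_eq_zero fun i _ => ?_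
  set e := chartAt (Fin n → ℂ) x
  have hx : x ∈ e.source := mem_chart_source _ x
  have h1 : (fun y => w (e.symm y)) =ᶠ[nhds (e x)] fun _ => 0 := by
    have h2 := e.continuousAt_symm (e.map_source hx)
    have h3 : (tsupport w)ᶜ ∈ nhds (e.symm (e x)) := by
      rw [e.left_inv hx]
      exact (isClosed_tsupport w).isOpen_compl.mem_nhds hw
    filter_upwards [h2 h3] with y hy
    exact image_eq_zero_of_notMem_tsupport hy
  rw [dz_congr h1, dz_const, mul_zero]

theorem smoothComplex_ofReal {f : X → ℝ} (hf : SmoothReal n f) :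
    SmoothComplex n fun x => (f x : ℂ) :=
  Complex.ofRealCLM.contDiff.contMDiff.comp hf

/-- For a real test function, the conjugate of `∂̄χ` is `∂χ`. The weak pairing therefore becomes a
derivative of `χ` along the gradient, to which the divergence theorem applies. -/
theorem inner01_dbar_ofReal (χ : X → ℝ) (x : X) :
    inner01 h (fun e y j => (G (e.symm y) : ℂ) * dbar u e y j) (dbar fun x => (χ x : ℂ)) x
      = G x * vecDeriv (grad h u) (fun x => (χ x : ℂ)) x := by
  rw [inner01_dbar, vecDeriv]
  simp only [conj_dzbar_ofReal]

theorem IsWeightPotential.eq_div (hΦ : IsWeightPotential h h₀ G t Φ) (hh : IsPositive h)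
    (he : e ∈ atlas (Fin n → ℂ) X) {y : Fin n → ℂ} (hy : y ∈ e.target) :
    G (e.symm y) = (n.factorial : ℝ) * 2 ^ n * Real.exp (Φ e y) / volDensity h e y :=
  (eq_div_iff (volDensity_pos hh he hy).ne').2 (hΦ.density e he y hy)

theorem IsWeightPotential.pos (hΦ : IsWeightPotential h h₀ G t Φ) (hh : IsPositive h) (x : X) :
    0 < G x := by
  have hx := mem_chart_source (Fin n → ℂ) x
  have hy := (chartAt (Fin n → ℂ) x).map_source hx
  have he := chart_mem_atlas (Fin n → ℂ) x
  have h1 := hΦ.eq_div hh he hy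
  rw [(chartAt (Fin n → ℂ) x).left_inv hx] at h1
  have := volDensity_pos hh he hy
  rw [h1]
  positivity

theorem IsWeightPotential.continuous (hΦ : IsWeightPotential h h₀ G t Φ) (hh : IsKahler h) :
    Continuous G := by
  refine continuous_of_comp_symm (n := n) fun e he => ?_
  refine ContinuousOn.congr ?_ fun y hy => hΦ.eq_div hh.positive he hy
  exact (continuousOn_const.mul (hΦ.smooth e he).continuousOn.rexp).div
    (contDiffOn_volDensity hh he).continuousOn fun y hy => (volDensity_pos hh.positive he hy).ne'

variable [IsManifold 𝓘(ℂ, Fin n → ℂ) ω X]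

theorem isVectorField_grad (hh : IsKahler h) (hu : SmoothComplex n u) :
    IsVectorField (grad h u) where
  smooth _ he i := contDiffOn_grad hh hu he i
  transform _ he _ he' _ hy k := grad_transform hh hu he he' hy k

theorem isVectorField_conjDerivGrad (hh : IsKahler h) (hu : SmoothComplex n u) :
    IsVectorField (conjDerivGrad h u) where
  smooth _ he l := contDiffOn_conjDerivGrad hh hu he l
  transform _ he _ he' _ hy k := conjDerivGrad_transform hh hu he he' hy k

theorem vecDeriv_symm (hv : IsVectorField v) (hw : SmoothComplex n w)
    (he : e ∈ atlas (Fin n → ℂ) X) {y : Fin n → ℂ} (hy : y ∈ e.target) :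
    vecDeriv v w (e.symm y) = ∑ i, v e i y * dz (fun y => w (e.symm y)) i y := by
  have he' := chart_mem_atlas (Fin n → ℂ) (e.symm y)
  have hy' : y ∈ (e.symm ≫ₕ chartAt (Fin n → ℂ) (e.symm y)).source := by
    simpa using hy
  exact sum_mul_dz_transform hw he he' hy' (hv.transform e he _ he' y hy')

theorem continuous_vecDeriv (hv : IsVectorField v) (hw : SmoothComplex n w) :
    Continuous (vecDeriv v w) := by
  refine continuous_of_comp_symm (n := n) fun e he => ?_
  refine ContinuousOn.congr ?_ fun y hy => vecDeriv_symm hv hw he hy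
  exact continuousOn_finsetSum _ fun i _ => (hv.smooth e he i).continuousOn.mul
    (contDiffOn_dz e.open_target (contDiffOn_comp_symm hw he) i).continuousOn

variable [MeasurableSpace X] [BorelSpace X]

/-- Weighted integrals of functions supported in the domain of a chart. -/
theorem IsWeightPotential.integral_mul_eq (hΦ : IsWeightPotential h h₀ G t Φ) (hh : IsKahler h)
    (he : e ∈ atlas (Fin n → ℂ) X) {F : X → ℂ} (hF : ContinuousOn F e.source)
    (hF0 : ∀ x ∉ e.source, F x = 0) :
    ∫ x, (G x : ℂ) * F x ∂(volMeasure h) = ((n.factorial : ℝ) * 2 ^ n : ℝ)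
      * ∫ y in e.target, Complex.exp (Φ e y : ℂ) * F (e.symm y) := by
  rw [integral_volMeasure_eq hh he (F := fun x => (G x : ℂ) * F x)
    ((Complex.continuous_ofReal.comp (hΦ.continuous hh)).continuousOn.mul hF)
    (fun x hx => by rw [hF0 x hx, mul_zero]), ← integral_const_mul]
  refine setIntegral_congr_fun e.open_target.measurableSet fun y hy => ?_
  have h1 : (G (e.symm y) : ℂ) * volDensity h e y
      = ((n.factorial : ℝ) * 2 ^ n : ℝ) * Complex.exp (Φ e y : ℂ) := by
    rw [← Complex.ofReal_exp]
    exact_mod_cast hΦ.density e he y hy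
  linear_combination F (e.symm y) * h1

variable [CompactSpace X]

/-- The divergence theorem for the vector field `χ v`, where `χ` is supported in the domain of the
chart `e`, with respect to the measure `G hⁿ`. -/
theorem IsWeightPotential.integral_vecDeriv (hΦ : IsWeightPotential h h₀ G t Φ)
    (hh : IsKahler h) (hv : IsVectorField v) (he : e ∈ atlas (Fin n → ℂ) X) {χ : X → ℝ}
    (hχ : SmoothReal n χ) (hχe : tsupport χ ⊆ e.source) :
    ∫ x, (G x : ℂ) * vecDeriv v (fun x => (χ x : ℂ)) x ∂(volMeasure h)
      = -(((n.factorial : ℝ) * 2 ^ n : ℝ) * ∫ y in e.target, Complex.exp (Φ e y : ℂ)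
        * (χ (e.symm y) * ∑ l, (dz (v e l) l y + dz (fun y => (Φ e y : ℂ)) l y * v e l y))) := by
  have hχc := smoothComplex_ofReal hχ
  have hK : IsCompact (e '' tsupport χ) :=
    (isClosed_tsupport χ).isCompact.image_of_continuousOn (e.continuousOn.mono hχe)
  have hKe : e '' tsupport χ ⊆ e.target := by
    rintro _ ⟨x, hx, rfl⟩
    exact e.map_source (hχe hx)
  have h0 := integral_divergence_eq_zero e.open_target hK hKe
    (contDiffOn_ofReal (hΦ.smooth e he)) (contDiffOn_comp_symm hχc he) (hv.smooth e he)
    (fun y hy hyK => by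
      have : e.symm y ∉ tsupport χ := fun hx => hyK ⟨_, hx, e.right_inv hy⟩
      simp [image_eq_zero_of_notMem_tsupport this])
  rw [hΦ.integral_mul_eq hh he (continuous_vecDeriv hv hχc).continuousOn
    (fun x hx => vecDeriv_eq_zero (by rw [tsupport_ofReal]; exact fun h => hx (hχe h))),
    ← mul_neg, ← eq_neg_of_add_eq_zero_right h0]
  congr 1
  refine setIntegral_congr_fun e.open_target.measurableSet fun y hy => ?_
  rw [vecDeriv_symm hv hχc he hy]

variable [T2Space X]

/-- The eigenvalue equation in local coordinates. -/
theorem IsWeightPotential.divergence_grad_eq (hΦ : IsWeightPotential h h₀ G t Φ)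
    (hh : IsKahler h) (hu : SmoothComplex n u) {c : ℂ}
    (hc : IsTwistedLaplacian h G u fun x => c * u x) (he : e ∈ atlas (Fin n → ℂ) X)
    {y : Fin n → ℂ} (hy : y ∈ e.target) :
    ∑ l, (dz (grad h u e l) l y + dz (fun y => (Φ e y : ℂ)) l y * grad h u e l y)
      = c * u (e.symm y) := by
  have := isManifold_real n X
  have := isFiniteMeasure_volMeasure hh
  have := isOpenPosMeasure_volMeasure hh
  have hv := isVectorField_grad hh hu
  set d : (Fin n → ℂ) → ℂ := fun y =>
    ∑ l, (dz (grad h u e l) l y + dz (fun y => (Φ e y : ℂ)) l y * grad h u e l y) with hd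
  have hdc : ContDiffOn ℝ ∞ d e.target :=
    ContDiffOn.sum fun l _ => (contDiffOn_dz e.open_target (hv.smooth e he l) l).add
      ((contDiffOn_dz e.open_target (contDiffOn_ofReal (hΦ.smooth e he)) l).mul
        (hv.smooth e he l))
  have huc : Continuous u := hu.continuous
  have hGc : Continuous fun x => (G x : ℂ) := Complex.continuous_ofReal.comp (hΦ.continuous hh)
  have hdX : ContinuousOn (fun x => d (e x)) e.source :=
    hdc.continuousOn.comp e.continuousOn e.mapsTo
  -- The weighted defect of the local equation. It is shown to vanish by the fundamental lemma of
  -- the calculus of variations, with real bump functions supported in the chart.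
  set f : X → ℂ := fun x => (G x : ℂ) * (d (e x) - c * u x) with hf
  have hfc : ContinuousOn f e.source :=
    hGc.continuousOn.mul (hdX.sub (continuous_const.mul huc).continuousOn)
  have hae : ∀ᵐ x ∂(volMeasure h), x ∈ e.source → f x = 0 := by
    refine e.open_source.ae_eq_zero_of_integral_contMDiff_smul_eq_zero 𝓘(ℝ, Fin n → ℂ)
      (hfc.locallyIntegrableOn e.open_source.measurableSet) fun χ hχ _ hχe => ?_
    have hχ0 : ∀ x ∉ e.source, χ x = 0 := fun x hx =>
      image_eq_zero_of_notMem_tsupport fun h => hx (hχe h)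
    have hχcont : Continuous fun x => (χ x : ℂ) := Complex.continuous_ofReal.comp hχ.continuous
    have h1 := hc.2 (fun x => (χ x : ℂ)) (smoothComplex_ofReal hχ)
    simp only [inner01_dbar_ofReal, Complex.conj_ofReal] at h1
    rw [hΦ.integral_vecDeriv hh hv he hχ hχe] at h1
    have h2 : ∫ x, -(G x : ℂ) * (c * u x) * (χ x : ℂ) ∂(volMeasure h)
        = -∫ x, (G x : ℂ) * ((χ x : ℂ) * (c * u x)) ∂(volMeasure h) := by
      rw [← integral_neg]
      congr 1
      ext x
      ring
    have hG1 : Continuous fun x => (χ x : ℂ) * (c * u x) :=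
      hχcont.mul (continuous_const.mul huc)
    have h4 : ∫ x, χ x • f x ∂(volMeasure h)
        = ∫ x, (G x : ℂ) * ((χ x : ℂ) * d (e x) - (χ x : ℂ) * (c * u x)) ∂(volMeasure h) := by
      congr 1
      ext x
      rw [hf, Complex.real_smul]
      ring
    have h5 : ∫ x, (G x : ℂ) * ((χ x : ℂ) * d (e x) - (χ x : ℂ) * (c * u x)) ∂(volMeasure h)
        = ((n.factorial : ℝ) * 2 ^ n : ℝ) * ∫ y in e.target, Complex.exp (Φ e y : ℂ)
          * (χ (e.symm y) * d y - χ (e.symm y) * (c * u (e.symm y))) := by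
      rw [hΦ.integral_mul_eq hh he (F := fun x => (χ x : ℂ) * d (e x) - (χ x : ℂ) * (c * u x))
        ((hχcont.continuousOn.mul hdX).sub hG1.continuousOn)
        (fun x hx => by rw [hχ0 x hx]; simp)]
      congr 1
      refine setIntegral_congr_fun e.open_target.measurableSet fun y hy => ?_
      rw [e.right_inv hy]
    have hK : IsCompact (e '' tsupport χ) :=
      (isClosed_tsupport χ).isCompact.image_of_continuousOn (e.continuousOn.mono hχe)
    have hKe : e '' tsupport χ ⊆ e.target := by
      rintro _ ⟨x, hx, rfl⟩
      exact e.map_source (hχe hx)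
    have hχ0' : ∀ y ∈ e.target, y ∉ e '' tsupport χ → χ (e.symm y) = 0 := fun y hy hyK =>
      image_eq_zero_of_notMem_tsupport fun hx => hyK ⟨_, hx, e.right_inv hy⟩
    have hexp : ContinuousOn (fun y => Complex.exp (Φ e y : ℂ)) e.target :=
      (contDiffOn_ofReal (hΦ.smooth e he)).continuousOn.cexp
    have hχe' : ContinuousOn (fun y => (χ (e.symm y) : ℂ)) e.target :=
      hχcont.comp_continuousOn e.continuousOn_symm
    have hue : ContinuousOn (fun y => u (e.symm y)) e.target :=
      huc.comp_continuousOn e.continuousOn_symm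
    rw [h2, hΦ.integral_mul_eq hh he hG1.continuousOn (fun x hx => by rw [hχ0 x hx]; simp),
      neg_inj] at h1
    have hint₁ : IntegrableOn
        (fun y => Complex.exp (Φ e y : ℂ) * ((χ (e.symm y) : ℂ) * d y)) e.target :=
      integrableOn_of_vanish e.open_target hK hKe (hexp.mul (hχe'.mul hdc.continuousOn))
        fun y hy hyK => by simp [hχ0' y hy hyK]
    have hint₂ : IntegrableOn
        (fun y => Complex.exp (Φ e y : ℂ) * ((χ (e.symm y) : ℂ) * (c * u (e.symm y)))) e.target :=
      integrableOn_of_vanish e.open_target hK hKe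
        (hexp.mul (hχe'.mul (continuousOn_const.mul hue))) fun y hy hyK => by simp [hχ0' y hy hyK]
    simp only [mul_sub] at h5
    rw [integral_sub hint₁ hint₂, mul_sub, h1, sub_self] at h5
    rw [h4]
    simpa only [mul_sub] using h5
  -- `f` is continuous on the chart domain and the measure is positive on nonempty open sets, so
  -- vanishing almost everywhere is vanishing everywhere.
  have hEq := Measure.eqOn_open_of_ae_eq
    ((ae_restrict_iff' e.open_source.measurableSet).2 hae : f =ᵐ[_] fun _ => 0)
    e.open_source hfc continuousOn_const
  have h1 := hEq (e.map_target hy)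
  simp only [hf, e.right_inv hy] at h1
  have hG : (G (e.symm y) : ℂ) ≠ 0 := by exact_mod_cast (hΦ.pos hh.positive _).ne'
  exact sub_eq_zero.1 ((mul_eq_zero.1 h1).resolve_left hG)

end GlobalIntegration

/-! ### The spectral gap -/

section SpectralGap

open MeasureTheory

theorem eq_ofReal_re_of_nonneg {z : ℂ} (hz : 0 ≤ z) : z = (z.re : ℂ) :=
  Complex.ext rfl (by simpa using (Complex.nonneg_iff.1 hz).2.symm)

theorem eq_zero_of_setIntegral_eq_zero {n : ℕ} {U : Set (Fin n → ℂ)} {f : (Fin n → ℂ) → ℝ}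
    (hU : IsOpen U) (hf : ContinuousOn f U) (hf0 : ∀ y ∈ U, 0 ≤ f y) (hfi : IntegrableOn f U)
    (hint : ∫ y in U, f y = 0) : ∀ y ∈ U, f y = 0 := by
  rw [setIntegral_eq_zero_iff_of_nonneg_ae
    ((ae_restrict_iff' hU.measurableSet).2 (Filter.Eventually.of_forall hf0)) hfi] at hint
  exact Measure.eqOn_open_of_ae_eq hint hU hf continuousOn_const

variable {n : ℕ} {X : Type*} [TopologicalSpace X] [ChartedSpace (Fin n → ℂ) X]
  {h h₀ : Form11 n X} {G : X → ℝ} {t : ℝ}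
  {Φ : OpenPartialHomeomorph X (Fin n → ℂ) → (Fin n → ℂ) → ℝ} {u : X → ℂ}

/-- The sum is the derivative of the constant `1`. This is what makes the boundary terms of the
localized divergence theorems cancel globally. -/
theorem vecDeriv_sum_eq_zero [IsManifold 𝓘(ℂ, Fin n → ℂ) ω X] {ι : Type*} [Fintype ι]
    {v : OpenPartialHomeomorph X (Fin n → ℂ) → Fin n → (Fin n → ℂ) → ℂ} {χ : ι → X → ℝ}
    (hχ : ∀ a, SmoothReal n (χ a)) (hsum : ∀ x, ∑ a, χ a x = 1) (x : X) :
    ∑ a, vecDeriv v (fun x => (χ a x : ℂ)) x = 0 := by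
  unfold vecDeriv
  rw [Finset.sum_comm]
  refine Finset.sum_eq_zero fun i _ => ?_
  set e := chartAt (Fin n → ℂ) x
  have he : e ∈ atlas (Fin n → ℂ) X := chart_mem_atlas _ x
  have hy : e x ∈ e.target := e.map_source (mem_chart_source _ x)
  rw [← Finset.mul_sum, ← dz_sum fun a _ => differentiableAt_of_contDiffOn e.open_target
    (contDiffOn_comp_symm (smoothComplex_ofReal (hχ a)) he) hy]
  have h1 : (fun y => ∑ a, (χ a (e.symm y) : ℂ)) = fun _ => 1 := by
    ext y
    exact_mod_cast hsum (e.symm y)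
  rw [h1, dz_const, mul_zero]

theorem IsWeightPotential.integral_mul_normSq_pos [IsManifold 𝓘(ℂ, Fin n → ℂ) ω X] [CompactSpace X]
    [MeasurableSpace X] [BorelSpace X] (hΦ : IsWeightPotential h h₀ G t Φ)
    (hh : IsKahler h) (hu : Continuous u) (hu0 : u ≠ 0) :
    0 < ∫ x, G x * Complex.normSq (u x) ∂(volMeasure h) := by
  have := isFiniteMeasure_volMeasure hh
  have := isOpenPosMeasure_volMeasure hh
  obtain ⟨x, hx⟩ := Function.ne_iff.1 hu0
  refine Continuous.integral_pos_of_hasCompactSupport_nonneg_nonzero (x := x)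
    ((hΦ.continuous hh).mul (Complex.continuous_normSq.comp hu))
    (HasCompactSupport.of_compactSpace _)
    (fun x => mul_nonneg (hΦ.pos hh.positive x).le (Complex.normSq_nonneg _)) ?_
  exact mul_ne_zero (hΦ.pos hh.positive x).ne' (by simpa using hx)

/-- The weak eigenvalue equation tested against `u` itself. It serves both for the reality of `c`
and for the final conclusion `c = 0`. -/
theorem neg_mul_integral_normSq_eq [MeasurableSpace X] {c : ℂ} (hu : SmoothComplex n u)
    (hc : IsTwistedLaplacian h G u fun x => c * u x) :
    -c * (∫ x, G x * Complex.normSq (u x) ∂(volMeasure h) : ℝ)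
      = ∫ x, inner01 h (fun e y j => (G (e.symm y) : ℂ) * dbar u e y j) (dbar u) x
        ∂(volMeasure h) := by
  rw [← hc.2 u hu, ← integral_complex_ofReal, ← integral_const_mul]
  congr 1
  ext x
  push_cast
  rw [← Complex.mul_conj]
  ring

variable (n X) in
/-- A finite smooth partition of unity subordinate to charts. -/
theorem exists_finite_partition [IsManifold 𝓘(ℂ, Fin n → ℂ) ω X] [CompactSpace X] [T2Space X] :
    ∃ (s : Finset X) (χ : s → X → ℝ),
    (∀ a, SmoothReal n (χ a)) ∧ (∀ a x, 0 ≤ χ a x) ∧ (∀ x, ∑ a, χ a x = 1) ∧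
      ∀ a, tsupport (χ a) ⊆ (chartAt (Fin n → ℂ) (a : X)).source := by
  have := isManifold_real n X
  obtain ⟨s, hs⟩ := isCompact_univ.elim_finite_subcover
    (fun x : X => (chartAt (Fin n → ℂ) x).source) (fun x => (chartAt _ x).open_source)
    (fun x _ => Set.mem_iUnion.2 ⟨x, mem_chart_source _ x⟩)
  obtain ⟨f, hf⟩ := SmoothPartitionOfUnity.exists_isSubordinate 𝓘(ℝ, Fin n → ℂ)
    (isClosed_univ (X := X)) (fun x : s => (chartAt (Fin n → ℂ) (x : X)).source)
    (fun x => (chartAt _ (x : X)).open_source) (by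
      rw [Set.iUnion_subtype]
      exact hs)
  refine ⟨s, fun a => f a, fun a => (f a).contMDiff,
    fun a x => f.nonneg a x, fun x => ?_, hf⟩
  rw [← finsum_eq_sum_of_fintype]
  exact f.sum_eq_one (Set.mem_univ x)

variable [IsManifold 𝓘(ℂ, Fin n → ℂ) ω X] [CompactSpace X] [MeasurableSpace X] [BorelSpace X]

/-- The eigenvalues of the twisted Laplacian are real. -/
theorem IsWeightPotential.eigenvalue_im_eq_zero (hΦ : IsWeightPotential h h₀ G t Φ)
    (hh : IsKahler h) (hu : SmoothComplex n u) (hu0 : u ≠ 0) {c : ℂ}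
    (hc : IsTwistedLaplacian h G u fun x => c * u x) : c.im = 0 := by
  have hA := hΦ.integral_mul_normSq_pos hh hu.continuous hu0
  have h1 := neg_mul_integral_normSq_eq hu hc
  have h2 : ∀ x, inner01 h (fun e y j => (G (e.symm y) : ℂ) * dbar u e y j) (dbar u) x
      = ((inner01 h (fun e y j => (G (e.symm y) : ℂ) * dbar u e y j) (dbar u) x).re : ℂ) := by
    intro x
    have h3 : 0 ≤ inner01 h (fun e y j => (G (e.symm y) : ℂ) * dbar u e y j) (dbar u) x := by
      have he := chart_mem_atlas (Fin n → ℂ) x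
      have hy := (chartAt (Fin n → ℂ) x).map_source (mem_chart_source (Fin n → ℂ) x)
      rw [inner01_dbar, sum_grad_mul_conj_dzbar hh.positive he hy]
      refine mul_nonneg ?_ (sum_hermitian_nonneg (hh.positive _ he _ hy) fun i => grad h u _ i _)
      exact_mod_cast (hΦ.pos hh.positive x).le
    exact eq_ofReal_re_of_nonneg h3
  rw [integral_congr_ae (Filter.Eventually.of_forall h2), integral_complex_ofReal] at h1
  have h3 := congrArg Complex.im h1
  simp only [Complex.mul_im, Complex.ofReal_im, mul_zero, Complex.ofReal_re, zero_add,
    Complex.neg_im] at h3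
  simpa [hA.ne'] using h3

variable [T2Space X]

/-- If `c + t ≥ 0`, an eigenfunction with eigenvalue `c` is holomorphic. -/
theorem IsWeightPotential.grad_eq_zero (hΦ : IsWeightPotential h h₀ G t Φ)
    (hh : IsKahler h) (hh₀ : IsPositive h₀) (hu : SmoothComplex n u) {c : ℝ}
    (hc : IsTwistedLaplacian h G u fun x => c * u x) (hct : 0 ≤ c + t) (ht : t < 1) (x : X)
    (i : Fin n) : grad h u (chartAt (Fin n → ℂ) x) i (chartAt (Fin n → ℂ) x x) = 0 := by
  have := isFiniteMeasure_volMeasure hh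
  obtain ⟨s, χ, hχ, hχ0, hχ1, hχp⟩ := exists_finite_partition n X
  have hW := isVectorField_conjDerivGrad hh hu
  set e : s → OpenPartialHomeomorph X (Fin n → ℂ) := fun a => chartAt (Fin n → ℂ) (a : X)
  have he (a : s) : e a ∈ atlas (Fin n → ℂ) X := chart_mem_atlas _ _
  -- The weighted divergence of `∇_{V̄} V` in the chart `e a`, that is, the left side of the Bochner
  -- identity.
  set q : s → (Fin n → ℂ) → ℂ := fun a y => ∑ l, (dz (conjDerivGrad h u (e a) l) l y
    + dz (fun y => (Φ (e a) y : ℂ)) l y * conjDerivGrad h u (e a) l y) with hq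
  have hqc (a : s) : ContDiffOn ℝ ∞ (q a) (e a).target :=
    ContDiffOn.sum fun l _ => (contDiffOn_dz (e a).open_target (hW.smooth _ (he a) l) l).add
      ((contDiffOn_dz (e a).open_target (contDiffOn_ofReal (hΦ.smooth _ (he a))) l).mul
        (hW.smooth _ (he a) l))
  have hq0 (a : s) (y) (hy : y ∈ (e a).target) :
      0 ≤ q a y ∧ (q a y = 0 → ∀ l, grad h u (e a) l y = 0) :=
    divergence_nonneg (h := h (e a)) (h₀ := h₀ (e a)) (V := grad h u (e a)) (e a).open_target
      (contDiffOn_comp_symm hu (he a)) (contDiffOn_ofReal (hΦ.smooth _ (he a)))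
      (contDiffOn_grad hh hu (he a)) (hh.positive _ (he a)) (hh₀ _ (he a)) (hh.smooth _ (he a))
      (hh.closed _ (he a)) (fun y hy j => sum_mul_grad hh.positive (he a) hy j)
      (hΦ.curvature _ (he a)) (fun y hy => hΦ.divergence_grad_eq hh hu hc (he a) hy) hct ht hy
  have hGc : Continuous fun x => (G x : ℂ) := Complex.continuous_ofReal.comp (hΦ.continuous hh)
  have hsum : ∑ a, ∫ x, (G x : ℂ) * vecDeriv (conjDerivGrad h u) (fun x => (χ a x : ℂ)) x
      ∂(volMeasure h) = 0 := by
    have hint (a : s) : Integrable (fun x => (G x : ℂ)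
        * vecDeriv (conjDerivGrad h u) (fun x => (χ a x : ℂ)) x) (volMeasure h) :=
      (hGc.mul (continuous_vecDeriv hW
        (smoothComplex_ofReal (hχ a)))).integrable_of_hasCompactSupport
          (HasCompactSupport.of_compactSpace _)
    rw [← integral_finsetSum _ fun a _ => hint a]
    simp only [← Finset.mul_sum, vecDeriv_sum_eq_zero hχ hχ1, mul_zero, integral_zero]
  -- Integrating by parts in each chart turns `hsum` into the vanishing of `∑ ∫ χ_a e^Φ q_a`. All
  -- these integrands are nonnegative, so each of them vanishes.
  simp only [fun a => hΦ.integral_vecDeriv hh hW (he a) (hχ a) (hχp a)] at hsum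
  rw [Finset.sum_neg_distrib, neg_eq_zero, ← Finset.mul_sum] at hsum
  set f : s → (Fin n → ℂ) → ℝ := fun a y =>
    Real.exp (Φ (e a) y) * (χ a ((e a).symm y) * (q a y).re) with hf
  have hfq (a : s) : ∀ y ∈ (e a).target,
      Complex.exp (Φ (e a) y : ℂ) * (χ a ((e a).symm y) * q a y) = (f a y : ℂ) := fun y hy => by
    have h1 : q a y = ((q a y).re : ℂ) := eq_ofReal_re_of_nonneg (hq0 a y hy).1
    rw [h1, hf]
    push_cast
    simp
  have hf0 (a : s) : ∀ y ∈ (e a).target, 0 ≤ f a y := fun y hy =>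
    mul_nonneg (Real.exp_pos _).le
      (mul_nonneg (hχ0 a _) (Complex.nonneg_iff.1 (hq0 a y hy).1).1)
  have hfc (a : s) : ContinuousOn (f a) (e a).target :=
    (hΦ.smooth _ (he a)).continuousOn.rexp.mul
      ((((hχ a).continuous).comp_continuousOn (e a).continuousOn_symm).mul
        (Complex.continuous_re.comp_continuousOn (hqc a).continuousOn))
  have hfi (a : s) : IntegrableOn (f a) (e a).target := by
    have h1 : IntegrableOn (fun y => (f a y : ℂ)) (e a).target := by
      refine integrableOn_of_vanish (K := e a '' tsupport (χ a)) (e a).open_target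
        ((isClosed_tsupport _).isCompact.image_of_continuousOn
          ((e a).continuousOn.mono (hχp a))) ?_
        (Complex.continuous_ofReal.comp_continuousOn (hfc a)) fun y hy hyK => ?_
      · rintro _ ⟨x, hx, rfl⟩
        exact (e a).map_source (hχp a hx)
      · have : (e a).symm y ∉ tsupport (χ a) := fun hx => hyK ⟨_, hx, (e a).right_inv hy⟩
        simp [hf, image_eq_zero_of_notMem_tsupport this]
    exact h1.re
  have hsum' : ∑ a, ∫ y in (e a).target, f a y = 0 := by
    have h1 : (∑ a, ∫ y in (e a).target, Complex.exp (Φ (e a) y : ℂ)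
        * (χ a ((e a).symm y) * q a y)) = 0 := by
      refine (mul_eq_zero.1 hsum).resolve_left ?_
      have : ((n.factorial : ℝ) * 2 ^ n : ℝ) ≠ 0 := by positivity
      exact_mod_cast this
    have h2 : ∑ a, ((∫ y in (e a).target, f a y : ℝ) : ℂ) = 0 := by
      rw [← h1]
      refine Finset.sum_congr rfl fun a _ => ?_
      rw [← integral_complex_ofReal]
      exact (setIntegral_congr_fun (e a).open_target.measurableSet (hfq a)).symm
    exact_mod_cast h2
  obtain ⟨a, ha⟩ : ∃ a, χ a x ≠ 0 := by
    by_contra! hne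
    simpa [hne] using hχ1 x
  have hxa : x ∈ (e a).source := hχp a (subset_tsupport _ ha)
  have hya := (e a).map_source hxa
  have hfa := eq_zero_of_setIntegral_eq_zero (e a).open_target (hfc a) (hf0 a) (hfi a)
    ((Finset.sum_eq_zero_iff_of_nonneg fun a _ =>
      setIntegral_nonneg (e a).open_target.measurableSet (hf0 a)).1 hsum' a (Finset.mem_univ a))
    (e a x) hya
  have hqa : q a (e a x) = 0 := by
    have h1 : q a (e a x) = ((q a (e a x)).re : ℂ) :=
      eq_ofReal_re_of_nonneg (hq0 a _ hya).1
    have h2 : (q a (e a x)).re = 0 := by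
      simpa [hf, (e a).left_inv hxa, ha] using hfa
    rw [h1, h2, Complex.ofReal_zero]
  have hgrad := (hq0 a _ hya).2 hqa
  -- The gradient vanishes at `x` in the chart `e a`; the transformation law carries this over to
  -- the preferred chart at `x`.
  have hov : e a x ∈ ((e a).symm ≫ₕ chartAt (Fin n → ℂ) x).source := by
    simp [hya, (e a).left_inv hxa]
  have h1 := grad_transform hh hu (he a) (chart_mem_atlas _ x) hov i
  rw [(e a).left_inv hxa] at h1
  simp [h1, hgrad]

/-- The non-zero eigenvalues of the twisted Laplacian are real and less than `-t`. -/
theorem IsWeightPotential.eigenvalue_lt (hΦ : IsWeightPotential h h₀ G t Φ)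
    (hh : IsKahler h) (hh₀ : IsPositive h₀) (ht : t < 1) {c : ℂ} (hc : IsEigenvalue h G c)
    (hc0 : c ≠ 0) : c.im = 0 ∧ c.re + t < 0 := by
  obtain ⟨u, hu, hu0, hcu⟩ := hc
  have him := hΦ.eigenvalue_im_eq_zero hh hu hu0 hcu
  refine ⟨him, ?_⟩
  by_contra! hct
  have hcre : c = (c.re : ℂ) := Complex.ext rfl (by simp [him])
  have hcu' := hcu
  rw [hcre] at hcu'
  have hg := hΦ.grad_eq_zero hh hh₀ hu hcu' hct ht
  have h1 := neg_mul_integral_normSq_eq hu hcu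
  have hA := hΦ.integral_mul_normSq_pos hh hu.continuous hu0
  -- With zero gradient the Dirichlet energy vanishes, so `-c ∫ G |u|² = 0` although both factors
  -- are non-zero.
  simp only [inner01_dbar, hg, zero_mul, Finset.sum_const_zero, mul_zero, integral_zero] at h1
  refine mul_ne_zero (neg_ne_zero.2 hc0) ?_ h1
  exact_mod_cast hA.ne'

end SpectralGap

/-- The potential `-tφ + ρ₀ + log det ω₀` of the weighted volume form defined by a solution of the
continuity equation. -/
theorem isWeightPotential_of_solves {n : ℕ} {X : Type*} [TopologicalSpace X] [MeasurableSpace X]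
    [ChartedSpace (Fin n → ℂ) X] [IsManifold 𝓘(ℂ, Fin n → ℂ) ω X] {ω₀ : Form11 n X}
    {ρ₀ φ G : X → ℝ} {t : ℝ} (hω₀ : IsKahler ω₀) (hρ₀ : IsRicciPotential ω₀ ρ₀)
    (hφ : SmoothReal n φ) (hsol : SolvesContinuityEquation ω₀ ρ₀ t G φ) :
    IsWeightPotential (ω₀ + ddbar φ) ω₀ G t fun e y =>
      -t * φ (e.symm y) + ρ₀ (e.symm y) + Real.log (ω₀ e y).det.re := by
  have hdet {e : OpenPartialHomeomorph X (Fin n → ℂ)} (he : e ∈ atlas (Fin n → ℂ) X)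
      {y : Fin n → ℂ} (hy : y ∈ e.target) : 0 < (ω₀ e y).det.re :=
    (Complex.pos_iff.1 (hω₀.positive e he y hy).det_pos).1
  have hlog {e : OpenPartialHomeomorph X (Fin n → ℂ)} (he : e ∈ atlas (Fin n → ℂ) X) :
      ContDiffOn ℝ ∞ (fun y => Real.log (ω₀ e y).det.re) e.target :=
    (Complex.reCLM.contDiff.comp_contDiffOn (contDiffOn_det (hω₀.smooth e he))).log
      fun y hy => (hdet he hy).ne'
  refine ⟨fun e he => ?_, fun e he y hy => ?_, fun e he y hy l j => ?_⟩
  · exact ((contDiffOn_const.mul (contDiffOn_comp_symm hφ he)).add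
      (contDiffOn_comp_symm hρ₀.smooth he)).add (hlog he)
  · have h1 := hsol e he (e.symm y) (e.map_target hy)
    rw [e.right_inv hy] at h1
    rw [h1, volDensity, Real.exp_add _ (Real.log _), Real.exp_log (hdet he hy)]
    ring
  · have hφe := contDiffOn_ofReal (contDiffOn_comp_symm hφ he)
    have hρe := contDiffOn_ofReal (contDiffOn_comp_symm hρ₀.smooth he)
    have hLe := contDiffOn_ofReal (hlog he)
    have hU := e.open_target
    have hd {F : (Fin n → ℂ) → ℂ} (hF : ContDiffOn ℝ ∞ F e.target) {y : Fin n → ℂ}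
        (hy : y ∈ e.target) : DifferentiableAt ℝ F y :=
      differentiableAt_of_contDiffOn hU hF hy
    have h1 : dzbar (fun y => ((-t * φ (e.symm y) + ρ₀ (e.symm y)
        + Real.log (ω₀ e y).det.re : ℝ) : ℂ)) j =ᶠ[nhds y] fun y =>
        (-t : ℂ) * dzbar (fun y => (φ (e.symm y) : ℂ)) j y
          + dzbar (fun y => (ρ₀ (e.symm y) : ℂ)) j y
          + dzbar (fun y => (Real.log (ω₀ e y).det.re : ℂ)) j y := by
      filter_upwards [hU.mem_nhds hy] with z hz
      push_cast
      rw [dzbar_add (((hd hφe hz).const_mul _).fun_add (hd hρe hz)) (hd hLe hz),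
        dzbar_add ((hd hφe hz).const_mul _) (hd hρe hz), dzbar_const_mul _ (hd hφe hz)]
    have hφb := hd (contDiffOn_dzbar hU hφe j) hy
    have hρb := hd (contDiffOn_dzbar hU hρe j) hy
    have hLb := hd (contDiffOn_dzbar hU hLe j) hy
    rw [dz_congr h1, dz_add ((hφb.const_mul _).fun_add hρb) hLb,
      dz_add (hφb.const_mul _) hρb, dz_const_mul _ hφb]
    have h2 := congrFun (congrFun (hρ₀.eq e he y hy) l) j
    simp only [ricci, ddbar, Matrix.sub_apply, Matrix.of_apply] at h2
    simp only [ddbar, Pi.add_apply, Matrix.add_apply, Matrix.of_apply]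
    -- The left side is `t ∂∂̄φ - ∂∂̄ρ₀ + Ric(ω₀)`. As `Ric(ω₀) - ∂∂̄ρ₀ = ω₀`, this equals `t (ω₀ +
    -- ∂∂̄φ) + (1 - t) ω₀`.
    linear_combination h2

end GSoliton

end

/-! ### The spectral bound for solutions of the continuity equation -/

open GSoliton in
theorem proposition3p2 {n r : ℕ} {X : Type*} [TopologicalSpace X] [T2Space X] [CompactSpace X]
    [ConnectedSpace X] [MeasurableSpace X] [BorelSpace X] [ChartedSpace (Fin n → ℂ) X]
    [IsManifold 𝓘(ℂ, Fin n → ℂ) ω X]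
    (T : Torus n r X) (hT : T.IsMaximal)
    (ω₀ : Form11 n X) (hω₀ : IsKahler ω₀) (hTω₀ : ∀ s, PreservedBy (T.act s) ω₀)
    (ρ₀ : X → ℝ) (hρ₀ : IsRicciPotential ω₀ ρ₀)
    (φ : X → ℝ) (hφ : IsKahlerPotential T ω₀ φ)
    (μ : X → Fin r → ℝ) (hμ : IsMomentMap T (ω₀ + ddbar φ) μ)
    (g : (Fin r → ℝ) → ℝ) (hg : IsWeight (Set.range μ) g)
    (hg_norm : ∫ x, (g (μ x) - 1) ∂(volMeasure (ω₀ + ddbar φ)) = 0)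
    (t : ℝ) (ht₀ : 0 < t) (ht₁ : t < 1)
    (hsol : SolvesContinuityEquation ω₀ ρ₀ t (fun x => g (μ x)) φ) :
    ∀ c : ℂ, IsEigenvalue (ω₀ + ddbar φ) (fun x => g (μ x)) c → c ≠ 0 →
      c.im = 0 ∧ c.re + t < 0 := fun _ hc hc0 =>
  (isWeightPotential_of_solves hω₀ hρ₀ hφ.smooth hsol).eigenvalue_lt
    (isKahler_add_ddbar hω₀ hφ.smooth hφ.positive) hω₀.positive ht₁ hc hc0
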